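/- **Conventions.** Permutations in $S_n$ are multiplied from left to right, $(\pi_1\pi_2)(i)=\pi_2(\pi_1(i))$. Put $\mathrm{des}(\pi)=\{1\le i\le n-1:\pi(i)>\pi(i+1)\}$ and $\mathrm{maj}(\pi)=\sum_{i\in\mathrm{des}(\pi)}i$. For $2\le k\le n$ let $t_k$ be the permutation with one-line notation $[k;1;2;\dots;k-1;k+1;\dots;n]$. The standard OGS canonical form of $\pi$ is its (unique) presentation $\pi=t_2^{e_2}t_3^{e_3}\cdots t_n^{e_n}$ with $0\le e_k<k$; put $e_k=0$ for $k\notin\{2,\dots,n\}$. A standard OGS elementary factorization of $\pi$ is a presentation $\pi=\prod_{v=1}^{z}\pi^{(v)}$, $\pi^{(v)}=\prod_{j=1}^{m^{(v)}}t_{h^{(v)}_j}^{\imath^{(v)}_j}$, with $m^{(v)}\ge 1$, $2\le h^{(v)}_1<\dots<h^{(v)}_{m^{(v)}}\le n$, $0<\imath^{(v)}_j<h^{(v)}_j$, $\sum_{j}\imath^{(v)}_j\le h^{(v)}_1$ for all $v$, and $h^{(v-1)}_{m^{(v-1)}}\le\sum_j\imath^{(v)}_j$ for $2\le v\le z$,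 in which the number $z$ of factors is the minimal possible one; this minimum is denoted $z(\pi)$. (The identity has $z=0$.) For such a factorization and $1\le v\le z(\pi)$, $1\le j\le m^{(v)}$, put $\rho^{(v)}_j=\sum_{x=j}^{m^{(v)}}\imath^{(v)}_x$, $\varrho^{(v)}_j=\sum_{x=1}^{j}\imath^{(v)}_x$, $\varrho^{(v)}_0=0$, and $\vartheta^{(v)}_j=h^{(v)}_j-\rho^{(v)}_1\ge0$. For $v\le r\le z(\pi)$ define recursively $\kappa^{(v\to v)}_{-;j}=\vartheta^{(v)}_j+\varrho^{(v)}_{j-1}$, $\kappa^{(v\to v)}_{+;j}=\vartheta^{(v)}_j+\varrho^{(v)}_{j}$, and $\kappa^{(v\to r+1)}_{-;j}=\kappa^{(v\to r)}_{-;j}+\vartheta^{(r+1)}_{j'}$ for the $j'$ with $\varrho^{(r+1)}_{j'-1}\le\kappa^{(v\to r)}_{-;j}<\varrho^{(r+1)}_{j'}$, and $\kappa^{(v\to r+1)}_{+;j}=\kappa^{(v\to r)}_{+;j}+\vartheta^{(r+1)}_{j''}$ for the $j''$ with $\varrho^{(r+1)}_{j''-1}<\kappa^{(v\to r)}_{+;j}\le\varrho^{(r+1)}_{j''}$.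 Put $\kappa^{(v)}_{\pm;j}=\kappa^{(v\to z(\pi))}_{\pm;j}$. Let $\chi^{(v)}_j$ be the largest $v'$ with $1\le v'<v$ such that $\kappa^{(v')}_{+;j'}\le\kappa^{(v)}_{+;j}<\kappa^{(v')}_{-;j'+1}$ for some $1\le j'<m^{(v')}$, or $\kappa^{(v)}_{+;j}<\kappa^{(v')}_{-;1}$, or $\kappa^{(v')}_{+;m^{(v')}}\le\kappa^{(v)}_{+;j}$; put $\chi^{(v)}_j=0$ if there is no such $v'$. Finally let $\eta^{(v)}_0=0$ and $\eta^{(v)}_j=\sum_{v'=\chi^{(v)}_j+1}^{v-1}\vartheta^{(v')}_{j_{v'}}$ for $1\le j\le m^{(v)}$, where $j_{v'}$ is the index with $\kappa^{(v')}_{-;j_{v'}}<\kappa^{(v)}_{+;j}<\kappa^{(v')}_{+;j_{v'}}$. **Theorem.** Every $\pi\in S_n$ has a standard OGS elementary factorization. For any such factorization of $\pi$, with the numbers defined above ($v$ always ranges over $1,\dots,z(\pi)$ and $j$ over $1,\dots,m^{(v)}$): 1. The exponents $e_k$ of the standard OGS canonical form $\pi^{-1}=\prod_{k=2}^n t_k^{e_k}$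 satisfy: - if $e_k\neq0$, then $k=\kappa^{(v)}_{-;j}$ or $k=\kappa^{(v)}_{+;j}$ for some $v,j$; - if $k=\kappa^{(v)}_{+;j}$ for some $v,j$, then $e_k=\sum(\vartheta^{(v')}_{j'}+\eta^{(v')}_{j'})$, summed over all pairs $(v',j')$ with $\kappa^{(v')}_{+;j'}=k$; - if $k=\kappa^{(v)}_{-;j}$ for some $v,j$, then $e_k=k-\sum(\vartheta^{(v')}_{j'}+\eta^{(v')}_{j'-1})$, summed over all pairs $(v',j')$ with $\kappa^{(v')}_{-;j'}=k$. 2. $z(\pi^{-1})$ is the number of different nonzero values among the $\kappa^{(v)}_{-;j}$. 3. Let $\pi^{-1}=\prod_{w=1}^{z(\pi^{-1})}(\pi^{-1})^{(w)}$ be a standard OGS elementary factorization. For every $w$, $\mathrm{maj}((\pi^{-1})^{(w)})$ is the sum of the exponents of the $w$-th factor and equals $\kappa^{(v)}_{-;j}$ for some $v,j$; and for every nonzero value $\kappa^{(v)}_{-;j}$ there is exactly one $w$ with $\mathrm{maj}((\pi^{-1})^{(w)})=\kappa^{(v)}_{-;j}$. 4. $\mathrm{des}(\pi^{-1})$ is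 the set of the different nonzero values $\kappa^{(v)}_{-;j}$; in particular $\pi^{-1}$ has exactly $z(\pi^{-1})$ descents. -/

import Mathlib

namespace OGS

/-- Left-to-right product of permutations: the leftmost factor is applied first, so
`lrProd [a, b]` is the map `i ↦ b (a i)`. (Multiplication in `Equiv.Perm` is composition, which
applies the rightmost factor first.) -/
def lrProd {n : ℕ} (l : List (Equiv.Perm (Fin n))) : Equiv.Perm (Fin n) :=
  l.reverse.prod

theorem lrProd_pair_apply {n : ℕ} (a b : Equiv.Perm (Fin n)) (i : Fin n) :
    lrProd [a, b] i = b (a i) := by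
  simp [lrProd]

/-- The generator `t_k` of `S_n`, `1 ≤ k ≤ n`: in one-line notation (with entries `1, …, n`) the
permutation `[k; 1; 2; …; k-1; k+1; …; n]`. The element `i : Fin n` stands for the point
`i + 1` of `{1, …, n}`. The value outside `1 ≤ k ≤ n` is irrelevant. -/
def tGen (n k : ℕ) : Equiv.Perm (Fin n) :=
  if hk : 1 ≤ k ∧ k ≤ n then (Fin.cycleRange (⟨k - 1, by omega⟩ : Fin n))⁻¹ else 1

theorem tGen_apply_zero {n k : ℕ} (h1 : 1 ≤ k) (h2 : k ≤ n) :
    tGen n k ⟨0, by omega⟩ = ⟨k - 1, by omega⟩ := by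
  have hn : NeZero n := ⟨by omega⟩
  have h := Fin.cycleRange_self (⟨k - 1, by omega⟩ : Fin n)
  rw [tGen, dif_pos ⟨h1, h2⟩, Equiv.Perm.inv_eq_iff_eq, h]
  rfl

theorem tGen_apply_lt {n k p : ℕ} (h2 : k ≤ n) (hp : 1 ≤ p) (hpk : p < k) :
    tGen n k ⟨p, by omega⟩ = ⟨p - 1, by omega⟩ := by
  rw [tGen, dif_pos ⟨by omega, h2⟩, Equiv.Perm.inv_eq_iff_eq]
  apply Fin.ext
  rw [Fin.coe_cycleRange_of_lt]
  · simp only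
    omega
  · rw [Fin.lt_def]
    simp only
    omega

theorem tGen_apply_ge {n k p : ℕ} (h1 : 1 ≤ k) (hkp : k ≤ p) (hp : p < n) :
    tGen n k ⟨p, hp⟩ = ⟨p, hp⟩ := by
  rw [tGen, dif_pos ⟨h1, by omega⟩, Equiv.Perm.inv_eq_iff_eq, Fin.cycleRange_of_gt]
  rw [Fin.lt_def]
  simp only
  omega

/-- `des(π)`: the set of all `1 ≤ i ≤ n - 1` with `π(i) > π(i+1)`
(points of `{1, …, n}`, i.e. the indices `i - 1` and `i` of `Fin n`). -/
def descents {n : ℕ} (π : Equiv.Perm (Fin n)) : Finset ℕ :=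
  (Finset.range n).filter fun i =>
    ∃ hi : 1 ≤ i ∧ i < n, π ⟨i, hi.2⟩ < π ⟨i - 1, by omega⟩

/-- The major index: the sum of the descents. -/
def majorIndex {n : ℕ} (π : Equiv.Perm (Fin n)) : ℕ :=
  ∑ i ∈ descents π, i

/-- `π = t_2^{e 2} · t_3^{e 3} ⋯ t_n^{e n}` with `0 ≤ e k < k` is the standard OGS canonical form
of `π`; by convention `e k = 0` for `k ∉ {2, …, n}`. -/
def IsCanonicalForm (n : ℕ) (e : ℕ → ℕ) (π : Equiv.Perm (Fin n)) : Prop :=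
  (∀ k, e k ≠ 0 → 2 ≤ k ∧ k ≤ n) ∧
  (∀ k, 2 ≤ k → k ≤ n → e k < k) ∧
  lrProd ((List.range' 2 (n - 1)).map fun k => tGen n k ^ e k) = π

/-- The word `t_{h 1}^{i 1} ⋯ t_{h m}^{i m}` is a nonempty word in standard OGS canonical form of
`S_n` with nonzero exponents, and it is elementary: the sum of its exponents is at most `h 1`. -/
def IsElementaryWord (n m : ℕ) (h i : ℕ → ℕ) : Prop :=
  1 ≤ m ∧
  (∀ j ∈ Finset.Icc 1 m, 2 ≤ h j ∧ h j ≤ n ∧ 0 < i j ∧ i j < h j) ∧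
  (∀ j ∈ Finset.Ico 1 m, h j < h (j + 1)) ∧
  ∑ x ∈ Finset.Icc 1 m, i x ≤ h 1

/-- The data of a product `∏_{v=1}^{z} ∏_{j=1}^{m v} t_{h v j}^{i v j}`. Only the values with
`1 ≤ v ≤ z` and `1 ≤ j ≤ m v` are meaningful. -/
structure Factors where
  /-- the number of factors -/
  z : ℕ
  /-- the number of letters of the `v`-th factor -/
  m : ℕ → ℕ
  /-- the index of the `j`-th letter of the `v`-th factor -/
  h : ℕ → ℕ → ℕ
  /-- the exponent of the `j`-th letter of the `v`-th factor -/
  i : ℕ → ℕ → ℕ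

namespace Factors

variable (F : Factors)

/-- `ρ^{(v)}_j`, the sum of the exponents `i v x` over `j ≤ x ≤ m v`. -/
def rho (v j : ℕ) : ℕ := ∑ x ∈ Finset.Icc j (F.m v), F.i v x

/-- `ϱ^{(v)}_j`, the sum of the exponents `i v x` over `1 ≤ x ≤ j`; so `ϱ^{(v)}_0 = 0`. -/
def varrho (v j : ℕ) : ℕ := ∑ x ∈ Finset.Icc 1 j, F.i v x

/-- `ϑ^{(v)}_j = h^{(v)}_j - ρ^{(v)}_1`. The subtraction never truncates for elementary
factors, as `ρ^{(v)}_1 ≤ h^{(v)}_1 ≤ h^{(v)}_j`. -/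
def vartheta (v j : ℕ) : ℕ := F.h v j - F.rho v 1

/-- The `v`-th factor `∏_{j=1}^{m v} t_{h v j}^{i v j}` as an element of `S_n`. -/
def factorPerm (n v : ℕ) : Equiv.Perm (Fin n) :=
  lrProd ((List.range' 1 (F.m v)).map fun j => tGen n (F.h v j) ^ F.i v j)

/-- `F` presents `π` as a product of elementary words, such that for consecutive factors
the last index of the `v`-th factor is at most the exponent sum of the `(v+1)`-st factor. -/
def IsFactorization (n : ℕ) (π : Equiv.Perm (Fin n)) : Prop :=
  (∀ v ∈ Finset.Icc 1 F.z, IsElementaryWord n (F.m v) (F.h v) (F.i v)) ∧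
  (∀ v ∈ Finset.Ico 1 F.z, F.h v (F.m v) ≤ F.rho (v + 1) 1) ∧
  lrProd ((List.range' 1 F.z).map fun v => F.factorPerm n v) = π

end Factors

/-- `z(π)`: the minimal number of factors in such a presentation of `π`. -/
noncomputable def factorCount (n : ℕ) (π : Equiv.Perm (Fin n)) : ℕ :=
  sInf {z | ∃ F : Factors, F.IsFactorization n π ∧ F.z = z}

namespace Factors

variable (F : Factors)

/-- `F` is a standard OGS elementary factorization of `π`. -/
def IsStandard (n : ℕ) (π : Equiv.Perm (Fin n)) : Prop :=
  F.IsFactorization n π ∧ F.z = factorCount n π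

/-- `kappaMinusStep v j d` is `κ^{(v → v+d)}_{-;j}`. The passage from `κ = κ^{(v → r)}_{-;j}` to
`κ^{(v → r+1)}_{-;j}` adds `ϑ^{(r+1)}_{j'}` for the `j'` with
`ϱ^{(r+1)}_{j'-1} ≤ κ < ϱ^{(r+1)}_{j'}` (at most one, as the intervals are disjoint). -/
def kappaMinusStep (v j : ℕ) : ℕ → ℕ
  | 0 => F.vartheta v j + F.varrho v (j - 1)
  | d + 1 => kappaMinusStep v j d +
      ∑ j' ∈ (Finset.Icc 1 (F.m (v + d + 1))).filter (fun j' =>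
          F.varrho (v + d + 1) (j' - 1) ≤ kappaMinusStep v j d ∧
          kappaMinusStep v j d < F.varrho (v + d + 1) j'),
        F.vartheta (v + d + 1) j'

/-- `kappaPlusStep v j d` is `κ^{(v → v+d)}_{+;j}`. The passage from `κ = κ^{(v → r)}_{+;j}` to
`κ^{(v → r+1)}_{+;j}` adds `ϑ^{(r+1)}_{j''}` for the `j''` with
`ϱ^{(r+1)}_{j''-1} < κ ≤ ϱ^{(r+1)}_{j''}`. -/
def kappaPlusStep (v j : ℕ) : ℕ → ℕ
  | 0 => F.vartheta v j + F.varrho v j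
  | d + 1 => kappaPlusStep v j d +
      ∑ j'' ∈ (Finset.Icc 1 (F.m (v + d + 1))).filter (fun j'' =>
          F.varrho (v + d + 1) (j'' - 1) < kappaPlusStep v j d ∧
          kappaPlusStep v j d ≤ F.varrho (v + d + 1) j''),
        F.vartheta (v + d + 1) j''

/-- `κ^{(v)}_{-;j} = κ^{(v → z)}_{-;j}`, for `1 ≤ v ≤ z` and `1 ≤ j ≤ m v`. -/
def kappaMinus (v j : ℕ) : ℕ := F.kappaMinusStep v j (F.z - v)

/-- `κ^{(v)}_{+;j} = κ^{(v → z)}_{+;j}`, for `1 ≤ v ≤ z` and `1 ≤ j ≤ m v`. -/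
def kappaPlus (v j : ℕ) : ℕ := F.kappaPlusStep v j (F.z - v)

/-- The number `κ^{(v)}_{+;j}` lies in one of the intervals
`[κ^{(v')}_{+;j'}, κ^{(v')}_{-;j'+1})` with `1 ≤ j' < m v'`, or below `κ^{(v')}_{-;1}`, or is at
least `κ^{(v')}_{+;m v'}`. -/
def ChiCond (v j v' : ℕ) : Prop :=
  (∃ j', (1 ≤ j' ∧ j' < F.m v') ∧
    F.kappaPlus v' j' ≤ F.kappaPlus v j ∧ F.kappaPlus v j < F.kappaMinus v' (j' + 1)) ∨
  F.kappaPlus v j < F.kappaMinus v' 1 ∨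
  F.kappaPlus v' (F.m v') ≤ F.kappaPlus v j

open scoped Classical in
/-- `χ^{(v)}_j`: the largest `1 ≤ v' < v` satisfying the preceding condition, and `0` if there is
no such `v'`. -/
noncomputable def chi (v j : ℕ) : ℕ :=
  ((Finset.Ico 1 v).filter fun v' => F.ChiCond v j v').sup id

/-- `η^{(v)}_j`: the sum over `χ^{(v)}_j < v' < v` of `ϑ^{(v')}_{j'}` for the `j'` with
`κ^{(v')}_{-;j'} < κ^{(v)}_{+;j} < κ^{(v')}_{+;j'}` (at most one, as the intervals are disjoint);
and `η^{(v)}_0 = 0`. -/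
noncomputable def eta (v j : ℕ) : ℕ :=
  if j = 0 then 0 else
    ∑ v' ∈ Finset.Ico (F.chi v j + 1) v,
      ∑ j' ∈ (Finset.Icc 1 (F.m v')).filter (fun j' =>
          F.kappaMinus v' j' < F.kappaPlus v j ∧ F.kappaPlus v j < F.kappaPlus v' j'),
        F.vartheta v' j'

/-- The set of all pairs `(v, j)` with `1 ≤ v ≤ z` and `1 ≤ j ≤ m v`. -/
def indices : Finset (Σ _ : ℕ, ℕ) :=
  (Finset.Icc 1 F.z).sigma fun v => Finset.Icc 1 (F.m v)

/-- The set of the different nonzero values among the `κ^{(v)}_{-;j}`. -/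
def kappaMinusValues : Finset ℕ :=
  (F.indices.image fun p => F.kappaMinus p.1 p.2).erase 0

end Factors

end OGS

/-!
The proof reads everything off one-line notations. An elementary word of exponent sum `ρ` cuts the
positions `1, …, ρ` into blocks, translates the `j`-th block by `ϑ_j`, where `ϑ_1 < ϑ_2 < ⋯`, and
keeps the positions beyond `ρ` in order (`IsElementaryWord.prefix_spec`). So it is a permutation
whose only descent is `ρ`, and every such permutation arises (`exists_elementaryWord`). In an
elementary factorization the first `v - 1` factors only act on positions up to `ρ^{(v)}`, hence
descents occur only at the exponent sums of the factors; sorting the values up to the last descent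
splits off a last factor, which gives a factorization with one factor per descent
(`exists_chain`). Therefore `z(π)` is the number of descents of `π`
(`factorCount_eq_card_descents`), and the descents are the exponent sums of a standard
factorization.

Let `G_v` be the product of the factors `v, …, z`. It is increasing on the blocks of the `v`-th
factor, and `κ^{(v)}_{+;j}` and `κ^{(v)}_{-;j} + 1` are its values at the last and the first
position of the `j`-th block (`kappaPlus_eq`, `kappaMinus_add_one`). Follow the positions of two
values `k` and `k + 1` in `G_z, G_{z-1}, …, G_1 = π`. As long as they lie in a common block they
remain neighbours; a value that once lies beyond the blocks is not moved any more. They are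
separated either with `k + 1` at the start of a block and `k` beyond the blocks, that is, `k =
κ_-`, which makes `k` a descent of `π⁻¹`; or with `k` at the end of a block and `k + 1` beyond the
blocks, that is, `k = κ_+`, which makes `k` an ascent; or else both lie beyond the blocks. This
determines the descents of `π⁻¹` (`Factors.IsFactorization.descents_inv`), and with the first
paragraph all statements about `z(π⁻¹)` and the major indices.

As for the exponents, let `S_k` be the number of `i < k` with `π⁻¹(i) > π⁻¹(k)`. The exponent of
`t_k` in the canonical form of `π⁻¹` is `S_k - S_{k+1}`, increased by `k` if `k` is a descent
(`isCanonicalForm_canonicalExp`, `canonicalExp_of_lt`, `canonicalExp_of_gt`). A factor contributes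
to `S_k` the amount `ϑ_j` of the block that contains `k` at its level (`lehmer_eq_sum_shift`). If
`k = κ_+` and `v` is the last level at which `k` ends a block, then the contributions to `S_k` and
`S_{k+1}` agree above `v`, and `k + 1` has none from `v` downwards; so the exponent is the sum of
the contributions to `S_k` of the levels up to `v`. The number `η` attached to a level where `k`
ends a block collects the contributions between that level and the next lower one of this kind, or
the one from which on `k` lies beyond the blocks: this is what `χ` detects (`pos_of_chi_lt`,
`pos_chi`, `eta_eq_sum_shift`). Summing over these levels gives the formula
(`sum_eq_sum_of_telescoping`, `sum_kappaPlus`). For `k = κ_-` the roles of `k` and `k + 1` are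
exchanged (`sum_kappaMinus`).
-/

namespace OGS

/-! ### Permutations of `{1, …, n}` as permutations of `ℕ` -/

/-- The permutation of `ℕ` that acts on `{1, …, n}` as `π ∈ S_n` and fixes everything else, where
`i : Fin n` stands for the point `i + 1`. -/
noncomputable def natPerm (n : ℕ) : Equiv.Perm (Fin n) →* Equiv.Perm ℕ :=
  Equiv.Perm.viaEmbeddingHom ⟨fun i : Fin n => i.1 + 1, fun a b h => Fin.ext (by simpa using h)⟩

theorem natPerm_apply_succ {n : ℕ} (π : Equiv.Perm (Fin n)) (i : Fin n) :
    natPerm n π (i.1 + 1) = (π i).1 + 1 :=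
  Equiv.Perm.viaEmbedding_apply π
    ⟨fun i : Fin n => i.1 + 1, fun a b h => Fin.ext (by simpa using h)⟩ i

theorem natPerm_apply {n : ℕ} (π : Equiv.Perm (Fin n)) {p : ℕ} (h1 : 1 ≤ p) (hn : p ≤ n) :
    natPerm n π p = (π ⟨p - 1, by omega⟩).1 + 1 := by
  rw [← natPerm_apply_succ]
  congr 1
  simp only
  omega

theorem natPerm_apply_of_not {n : ℕ} (π : Equiv.Perm (Fin n)) {p : ℕ} (h : ¬ (1 ≤ p ∧ p ≤ n)) :
    natPerm n π p = p := by
  refine Equiv.Perm.viaEmbedding_apply_of_notMem π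
    ⟨fun i : Fin n => i.1 + 1, fun a b h => Fin.ext (by simpa using h)⟩ p ?_
  rintro ⟨i, rfl⟩
  exact h ⟨Nat.succ_pos i.1, i.2⟩

theorem natPerm_injective (n : ℕ) : Function.Injective (natPerm n) :=
  Equiv.Perm.viaEmbeddingHom_injective _

/-- The generator `t_k` as a permutation of `ℕ`. -/
noncomputable def tNat (k : ℕ) : Equiv.Perm ℕ := natPerm k (tGen k k)

theorem natPerm_tGen_apply {n k p : ℕ} (h1 : 1 ≤ k) (hk : k ≤ n) :
    natPerm n (tGen n k) p = if p = 1 then k else if 1 ≤ p ∧ p ≤ k then p - 1 else p := by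
  by_cases hp : 1 ≤ p ∧ p ≤ n
  · rw [natPerm_apply _ hp.1 hp.2]
    by_cases hp1 : p = 1
    · subst hp1
      rw [if_pos rfl]
      have := tGen_apply_zero h1 hk
      simp only [Nat.sub_self]
      rw [this]
      simp only
      omega
    · rw [if_neg hp1]
      by_cases hpk : p ≤ k
      · rw [if_pos ⟨hp.1, hpk⟩, tGen_apply_lt hk (by omega) (by omega)]
        simp only
        omega
      · rw [if_neg (by omega), tGen_apply_ge h1 (by omega)]
        simp only
        omega
  · rw [natPerm_apply_of_not _ hp, if_neg (by omega), if_neg (by omega)]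

theorem tNat_apply {k p : ℕ} (h1 : 1 ≤ k) :
    tNat k p = if p = 1 then k else if 1 ≤ p ∧ p ≤ k then p - 1 else p :=
  natPerm_tGen_apply h1 le_rfl

theorem natPerm_tGen {n k : ℕ} (h1 : 1 ≤ k) (hk : k ≤ n) : natPerm n (tGen n k) = tNat k := by
  ext p
  rw [natPerm_tGen_apply h1 hk, tNat_apply h1]

theorem tNat_pow_apply {k e p : ℕ} (h1 : 1 ≤ k) (he : e ≤ k) :
    (tNat k ^ e) p =
      if 1 ≤ p ∧ p ≤ k then (if p ≤ e then p + (k - e) else p - e) else p := by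
  induction e with
  | zero =>
    simp only [pow_zero, Equiv.Perm.coe_one, id]
    split_ifs <;> omega
  | succ e ih =>
    rw [pow_succ', Equiv.Perm.mul_apply, ih (by omega), tNat_apply h1]
    split_ifs <;> omega

/-! ### Left-to-right products -/

/-- The product `f 1 · f 2 ⋯ f s`, in which `f 1` is applied first. -/
def prefixProd {G : Type*} [Monoid G] (f : ℕ → G) : ℕ → G
  | 0 => 1
  | s + 1 => f (s + 1) * prefixProd f s

theorem reverse_prod_range' {G : Type*} [Monoid G] (f : ℕ → G) (s : ℕ) :
    ((List.range' 1 s).map f).reverse.prod = prefixProd f s := by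
  induction s with
  | zero => rfl
  | succ s ih =>
    rw [List.range'_concat]
    simp [prefixProd, ih, Nat.add_comm]

theorem prefixProd_congr {G : Type*} [Monoid G] {f g : ℕ → G} {s : ℕ}
    (h : ∀ j ∈ Finset.Icc 1 s, f j = g j) : prefixProd f s = prefixProd g s := by
  induction s with
  | zero => rfl
  | succ s ih =>
    simp only [prefixProd]
    rw [h (s + 1) (by simp), ih fun j hj => h j (by simp at hj ⊢; omega)]

theorem map_prefixProd {G H : Type*} [Monoid G] [Monoid H] (φ : G →* H) (f : ℕ → G) (s : ℕ) :
    φ (prefixProd f s) = prefixProd (fun j => φ (f j)) s := by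
  induction s with
  | zero => simp [prefixProd]
  | succ s ih => simp [prefixProd, ih]

theorem sum_Icc_one_succ (f : ℕ → ℕ) (s : ℕ) :
    ∑ x ∈ Finset.Icc 1 (s + 1), f x = ∑ x ∈ Finset.Icc 1 s, f x + f (s + 1) :=
  Finset.sum_Icc_succ_top (by omega) f

theorem sum_Icc_one_mono (f : ℕ → ℕ) {s t : ℕ} (h : s ≤ t) :
    ∑ x ∈ Finset.Icc 1 s, f x ≤ ∑ x ∈ Finset.Icc 1 t, f x :=
  Finset.sum_le_sum_of_subset (Finset.Icc_subset_Icc_right h)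

/-- An index whose interval `(f 1 + ⋯ + f (j-1), f 1 + ⋯ + f j]` contains `p` exists for every `p`
between `1` and the total sum. -/
theorem exists_block (f : ℕ → ℕ) (m p : ℕ) (hp : 1 ≤ p) (hpm : p ≤ ∑ x ∈ Finset.Icc 1 m, f x) :
    ∃ j, 1 ≤ j ∧ j ≤ m ∧ ∑ x ∈ Finset.Icc 1 (j - 1), f x < p ∧
      p ≤ ∑ x ∈ Finset.Icc 1 j, f x := by
  induction m with
  | zero => simp at hpm; omega
  | succ m ih =>
    by_cases h : p ≤ ∑ x ∈ Finset.Icc 1 m, f x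
    · obtain ⟨j, h1, h2, h3⟩ := ih h
      exact ⟨j, h1, by omega, h3⟩
    · exact ⟨m + 1, by omega, le_rfl, by simpa using h, hpm⟩

/-- The intervals `(f 1 + ⋯ + f (j-1), f 1 + ⋯ + f j]` are disjoint. -/
theorem block_unique {f : ℕ → ℕ} {p j j' : ℕ} (hj : 1 ≤ j) (hj' : 1 ≤ j')
    (h1 : ∑ x ∈ Finset.Icc 1 (j - 1), f x < p) (h2 : p ≤ ∑ x ∈ Finset.Icc 1 j, f x)
    (h1' : ∑ x ∈ Finset.Icc 1 (j' - 1), f x < p) (h2' : p ≤ ∑ x ∈ Finset.Icc 1 j', f x) :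
    j = j' := by
  rcases lt_trichotomy j j' with h | h | h
  · have := sum_Icc_one_mono f (show j ≤ j' - 1 by omega)
    omega
  · exact h
  · have := sum_Icc_one_mono f (show j' ≤ j - 1 by omega)
    omega

/-! ### Elementary words -/

/-- The word `t_{h 1}^{i 1} ⋯ t_{h s}^{i s}` as a permutation of `ℕ`. -/
noncomputable def wordPerm (h i : ℕ → ℕ) (s : ℕ) : Equiv.Perm ℕ :=
  prefixProd (fun j => tNat (h j) ^ i j) s

theorem wordPerm_succ (h i : ℕ → ℕ) (s p : ℕ) :
    wordPerm h i (s + 1) p = (tNat (h (s + 1)) ^ i (s + 1)) (wordPerm h i s p) := rfl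

namespace IsElementaryWord

variable {n m : ℕ} {h i : ℕ → ℕ}

theorem letter (hw : IsElementaryWord n m h i) {j : ℕ} (h1 : 1 ≤ j) (h2 : j ≤ m) :
    2 ≤ h j ∧ h j ≤ n ∧ 0 < i j ∧ i j < h j :=
  hw.2.1 j (Finset.mem_Icc.2 ⟨h1, h2⟩)

theorem h_lt (hw : IsElementaryWord n m h i) {j j' : ℕ} (h1 : 1 ≤ j) (hjj : j < j')
    (h2 : j' ≤ m) : h j < h j' := by
  induction j', hjj using Nat.le_induction with
  | base => exact hw.2.2.1 j (Finset.mem_Ico.2 ⟨h1, h2⟩)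
  | succ k hk ih =>
    exact (ih (by omega)).trans (hw.2.2.1 k (Finset.mem_Ico.2 ⟨by omega, h2⟩))

theorem h_le (hw : IsElementaryWord n m h i) {j j' : ℕ} (h1 : 1 ≤ j) (hjj : j ≤ j')
    (h2 : j' ≤ m) : h j ≤ h j' := by
  rcases hjj.eq_or_lt with rfl | hlt
  · exact le_rfl
  · exact (hw.h_lt h1 hlt h2).le

theorem sum_lt (hw : IsElementaryWord n m h i) {j j' : ℕ} (hjj : j < j') (h2 : j' ≤ m) :
    ∑ x ∈ Finset.Icc 1 j, i x < ∑ x ∈ Finset.Icc 1 j', i x := by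
  obtain ⟨k, rfl⟩ : ∃ k, j' = k + 1 := ⟨j' - 1, by omega⟩
  have h3 := sum_Icc_one_mono i (show j ≤ k by omega)
  have h4 := (hw.letter (j := k + 1) (by omega) h2).2.2.1
  rw [sum_Icc_one_succ]
  omega

/-- The one-line notation of a prefix of an elementary word: the first positions, as many as the
exponent sum, are cut into blocks of lengths `i 1, …, i s`, each of which is translated, and the
remaining positions stay in order. -/
theorem prefix_spec (hw : IsElementaryWord n m h i) (s : ℕ) (h1 : 1 ≤ s) (hs : s ≤ m) :
    (∀ j, 1 ≤ j → j ≤ s → ∀ p, ∑ x ∈ Finset.Icc 1 (j - 1), i x < p →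
      p ≤ ∑ x ∈ Finset.Icc 1 j, i x →
        wordPerm h i s p + ∑ x ∈ Finset.Icc 1 s, i x = p + h j) ∧
    (∀ p, ∑ x ∈ Finset.Icc 1 s, i x < p → p ≤ h 1 →
      wordPerm h i s p + ∑ x ∈ Finset.Icc 1 s, i x = p) ∧
    StrictMonoOn (wordPerm h i s) (Set.Ioi (∑ x ∈ Finset.Icc 1 s, i x)) ∧
    (∀ p, h s < p → wordPerm h i s p = p) := by
  induction s, h1 using Nat.le_induction with
  | base =>
    have hl := hw.letter le_rfl hs
    have hT : ∀ p, wordPerm h i 1 p =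
        if 1 ≤ p ∧ p ≤ h 1 then (if p ≤ i 1 then p + (h 1 - i 1) else p - i 1) else p :=
      fun p => tNat_pow_apply (k := h 1) (e := i 1) (by omega) (by omega)
    have hsum : ∑ x ∈ Finset.Icc 1 1, i x = i 1 := by simp
    rw [hsum]
    refine ⟨?_, ?_, ?_, ?_⟩
    · intro j hj1 hj2 p hp1 hp2
      obtain rfl : j = 1 := by omega
      rw [hsum] at hp2
      rw [hT]
      split_ifs <;> omega
    · intro p hp1 hp2
      rw [hT]
      split_ifs <;> omega
    · intro p hp q hq hpq
      simp only [Set.mem_Ioi] at hp hq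
      rw [hT, hT]
      split_ifs <;> omega
    · intro p hp
      rw [hT]
      split_ifs <;> omega
  | succ s hs1 ih =>
    obtain ⟨ha, hd, hb, hc⟩ := ih (by omega)
    have hl := hw.letter (j := s + 1) (by omega) hs
    have htot : ∑ x ∈ Finset.Icc 1 s, i x + i (s + 1) ≤ h 1 := by
      rw [← sum_Icc_one_succ]
      exact (sum_Icc_one_mono i hs).trans hw.2.2.2
    have hlt := hw.h_lt (j := s) (j' := s + 1) hs1 (by omega) hs
    have hle1 := hw.h_le (j := 1) (j' := s) le_rfl hs1 (by omega)
    have hT : ∀ q, (tNat (h (s + 1)) ^ i (s + 1)) q =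
        if 1 ≤ q ∧ q ≤ h (s + 1) then
          (if q ≤ i (s + 1) then q + (h (s + 1) - i (s + 1)) else q - i (s + 1)) else q :=
      fun q => tNat_pow_apply (by omega) (by omega)
    rw [sum_Icc_one_succ]
    set R := ∑ x ∈ Finset.Icc 1 s, i x with hR
    refine ⟨?_, ?_, ?_, ?_⟩
    · intro j hj1 hj2 p hp1 hp2
      rw [wordPerm_succ, hT]
      rcases hj2.eq_or_lt with rfl | hjs
      · rw [sum_Icc_one_succ, ← hR] at hp2
        simp only [Nat.add_sub_cancel] at hp1
        rw [← hR] at hp1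
        have := hd p hp1 (by omega)
        split_ifs <;> omega
      · have h3 := ha j hj1 (by omega) p hp1 hp2
        have h4 := hw.h_le (j := 1) (j' := j) le_rfl hj1 (by omega)
        have h5 := hw.h_le (j := j) (j' := s) hj1 (by omega) (by omega)
        have h6 := sum_Icc_one_mono i (show j ≤ s by omega)
        split_ifs <;> omega
    · intro p hp1 hp2
      rw [wordPerm_succ, hT]
      have := hd p (by omega) hp2
      split_ifs <;> omega
    · intro p hp q hq hpq
      simp only [Set.mem_Ioi] at hp hq
      -- the images lie above `i (s + 1)`, the image of the position `R + i (s + 1)`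
      have h3 := hd (R + i (s + 1)) (by omega) htot
      have h4 : wordPerm h i s (R + i (s + 1)) < wordPerm h i s p :=
        hb (by simp only [Set.mem_Ioi]; omega) (by simp only [Set.mem_Ioi]; omega) hp
      have h5 : wordPerm h i s p < wordPerm h i s q :=
        hb (by simp only [Set.mem_Ioi]; omega) (by simp only [Set.mem_Ioi]; omega) hpq
      rw [wordPerm_succ, wordPerm_succ, hT, hT]
      split_ifs <;> omega
    · intro p hp
      rw [wordPerm_succ, hc p (by omega), hT]
      split_ifs <;> omega

theorem apply_block (hw : IsElementaryWord n m h i) {j p : ℕ} (hj1 : 1 ≤ j) (hj2 : j ≤ m)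
    (hp1 : ∑ x ∈ Finset.Icc 1 (j - 1), i x < p) (hp2 : p ≤ ∑ x ∈ Finset.Icc 1 j, i x) :
    wordPerm h i m p = p + (h j - ∑ x ∈ Finset.Icc 1 m, i x) := by
  have h1 := (hw.prefix_spec m hw.1 le_rfl).1 j hj1 hj2 p hp1 hp2
  have h2 := hw.h_le le_rfl hj1 hj2
  have h3 := hw.2.2.2
  omega

theorem strictMonoOn_Ioi (hw : IsElementaryWord n m h i) :
    StrictMonoOn (wordPerm h i m) (Set.Ioi (∑ x ∈ Finset.Icc 1 m, i x)) :=
  (hw.prefix_spec m hw.1 le_rfl).2.2.1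

theorem apply_of_lt (hw : IsElementaryWord n m h i) {p : ℕ} (hp : h m < p) :
    wordPerm h i m p = p :=
  (hw.prefix_spec m hw.1 le_rfl).2.2.2 p hp

theorem sum_pos (hw : IsElementaryWord n m h i) : 0 < ∑ x ∈ Finset.Icc 1 m, i x := by
  simpa using hw.sum_lt (j := 0) (j' := m) hw.1 le_rfl

theorem sum_lt_top (hw : IsElementaryWord n m h i) : ∑ x ∈ Finset.Icc 1 m, i x < h m := by
  rcases hw.1.eq_or_lt with rfl | hm
  · simpa using (hw.letter le_rfl le_rfl).2.2.2
  · exact hw.2.2.2.trans_lt (hw.h_lt le_rfl hm le_rfl)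

theorem apply_zero (hw : IsElementaryWord n m h i) : wordPerm h i m 0 = 0 := by
  have : ∀ s ≤ m, wordPerm h i s 0 = 0 := by
    intro s hs
    induction s with
    | zero => rfl
    | succ s ih =>
      have hl := hw.letter (j := s + 1) (by omega) hs
      rw [wordPerm_succ, ih (by omega), tNat_pow_apply (by omega) (by omega)]
      simp
  exact this m le_rfl

theorem strictMonoOn_Iic (hw : IsElementaryWord n m h i) :
    StrictMonoOn (wordPerm h i m) (Set.Iic (∑ x ∈ Finset.Icc 1 m, i x)) := by
  intro p hp q hq hpq
  simp only [Set.mem_Iic] at hp hq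
  obtain ⟨j', hj1', hj2', hq1, hq2⟩ := exists_block i m q (by omega) hq
  rw [hw.apply_block hj1' hj2' hq1 hq2]
  rcases Nat.eq_zero_or_pos p with rfl | hp0
  · rw [hw.apply_zero]
    omega
  obtain ⟨j, hj1, hj2, hp1, hp2⟩ := exists_block i m p hp0 hp
  rw [hw.apply_block hj1 hj2 hp1 hp2]
  have hjj : j ≤ j' := by
    by_contra hlt
    have := sum_Icc_one_mono i (show j' ≤ j - 1 by omega)
    omega
  have := hw.h_le hj1 hjj hj2'
  omega

end IsElementaryWord

/-! ### Factorizations as permutations of `ℕ` -/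

namespace Factors

/-- The first two conditions of `IsFactorization`: every factor is an elementary word of `S_n`, and
the last index of each factor is at most the exponent sum of the next one. -/
def IsChain (F : Factors) (n : ℕ) : Prop :=
  (∀ v ∈ Finset.Icc 1 F.z, IsElementaryWord n (F.m v) (F.h v) (F.i v)) ∧
  (∀ v ∈ Finset.Ico 1 F.z, F.h v (F.m v) ≤ F.rho (v + 1) 1)

/-- The `v`-th factor as a permutation of `ℕ`. -/
noncomputable def factorNat (F : Factors) (v : ℕ) : Equiv.Perm ℕ :=
  wordPerm (F.h v) (F.i v) (F.m v)

/-- The product of the first `v` factors as a permutation of `ℕ`. -/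
noncomputable def prefixNat (F : Factors) (v : ℕ) : Equiv.Perm ℕ :=
  prefixProd F.factorNat v

theorem prefixNat_succ (F : Factors) (v p : ℕ) :
    F.prefixNat (v + 1) p = F.factorNat (v + 1) (F.prefixNat v p) := rfl

theorem natPerm_factorPerm {n v : ℕ} (F : Factors)
    (hw : IsElementaryWord n (F.m v) (F.h v) (F.i v)) :
    natPerm n (F.factorPerm n v) = F.factorNat v := by
  rw [factorPerm, lrProd, reverse_prod_range' (fun j => tGen n (F.h v j) ^ F.i v j),
    map_prefixProd]
  refine prefixProd_congr fun j hj => ?_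
  rw [Finset.mem_Icc] at hj
  have := hw.letter hj.1 hj.2
  rw [map_pow, natPerm_tGen (by omega) (by omega)]

theorem isFactorization_iff {n : ℕ} {F : Factors} {π : Equiv.Perm (Fin n)} :
    F.IsFactorization n π ↔ F.IsChain n ∧ F.prefixNat F.z = natPerm n π := by
  rw [IsFactorization, IsChain, and_assoc]
  refine and_congr_right fun h1 => and_congr_right fun _ => ?_
  rw [lrProd, reverse_prod_range' (fun v => F.factorPerm n v), ← (natPerm_injective n).eq_iff,
    map_prefixProd, prefixProd_congr fun v hv => F.natPerm_factorPerm (h1 v hv)]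
  rfl

theorem rho_one (F : Factors) (v : ℕ) : F.rho v 1 = F.varrho v (F.m v) := rfl

namespace IsChain

variable {F : Factors} {n : ℕ}

theorem word (hF : F.IsChain n) {v : ℕ} (h1 : 1 ≤ v) (h2 : v ≤ F.z) :
    IsElementaryWord n (F.m v) (F.h v) (F.i v) :=
  hF.1 v (Finset.mem_Icc.2 ⟨h1, h2⟩)

theorem top_le (hF : F.IsChain n) {v : ℕ} (h1 : 1 ≤ v) (h2 : v < F.z) :
    F.h v (F.m v) ≤ F.rho (v + 1) 1 :=
  hF.2 v (Finset.mem_Ico.2 ⟨h1, h2⟩)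

theorem rho_lt_top (hF : F.IsChain n) {v : ℕ} (h1 : 1 ≤ v) (h2 : v ≤ F.z) :
    F.rho v 1 < F.h v (F.m v) :=
  (hF.word h1 h2).sum_lt_top

theorem rho_lt (hF : F.IsChain n) {v w : ℕ} (h1 : 1 ≤ v) (hvw : v < w) (h2 : w ≤ F.z) :
    F.rho v 1 < F.rho w 1 := by
  induction w, hvw using Nat.le_induction with
  | base => exact (hF.rho_lt_top h1 (by omega)).trans_le (hF.top_le h1 h2)
  | succ k hk ih =>
    exact (ih (by omega)).trans
      ((hF.rho_lt_top (by omega) (by omega)).trans_le (hF.top_le (by omega) h2))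

theorem rho_le (hF : F.IsChain n) {v w : ℕ} (h1 : 1 ≤ v) (hvw : v ≤ w) (h2 : w ≤ F.z) :
    F.rho v 1 ≤ F.rho w 1 := by
  rcases hvw.eq_or_lt with rfl | h
  · exact le_rfl
  · exact (hF.rho_lt h1 h h2).le

theorem factorNat_zero (hF : F.IsChain n) {v : ℕ} (h1 : 1 ≤ v) (h2 : v ≤ F.z) :
    F.factorNat v 0 = 0 :=
  (hF.word h1 h2).apply_zero

theorem factorNat_of_top_lt (hF : F.IsChain n) {v p : ℕ} (h1 : 1 ≤ v) (h2 : v ≤ F.z)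
    (hp : F.h v (F.m v) < p) : F.factorNat v p = p :=
  (hF.word h1 h2).apply_of_lt hp

theorem strictMonoOn_Iic (hF : F.IsChain n) {v : ℕ} (h1 : 1 ≤ v) (h2 : v ≤ F.z) :
    StrictMonoOn (F.factorNat v) (Set.Iic (F.rho v 1)) :=
  (hF.word h1 h2).strictMonoOn_Iic

theorem strictMonoOn_Ioi (hF : F.IsChain n) {v : ℕ} (h1 : 1 ≤ v) (h2 : v ≤ F.z) :
    StrictMonoOn (F.factorNat v) (Set.Ioi (F.rho v 1)) :=
  (hF.word h1 h2).strictMonoOn_Ioi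

end IsChain
end Factors

theorem perm_apply_inv {α : Type*} (u : Equiv.Perm α) (p : α) : u (u⁻¹ p) = p :=
  u.apply_symm_apply p

theorem perm_inv_apply {α : Type*} (u : Equiv.Perm α) (p : α) : u⁻¹ (u p) = p :=
  u.symm_apply_apply p

theorem apply_le_iff_of_fixed {τ : Equiv.Perm ℕ} {R : ℕ} (h : ∀ p, R < p → τ p = p) (p : ℕ) :
    τ p ≤ R ↔ p ≤ R := by
  constructor
  · intro hp
    by_contra hlt
    rw [h p (by omega)] at hp
    omega
  · intro hp
    by_contra hlt
    have := τ.injective (h (τ p) (by omega))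
    omega

theorem Factors.IsChain.prefixNat_of_lt {F : Factors} {n : ℕ} (hF : F.IsChain n) {v p : ℕ}
    (h2 : v < F.z) (hp : F.rho (v + 1) 1 < p) : F.prefixNat v p = p := by
  induction v with
  | zero => rfl
  | succ v ih =>
    have h3 := hF.rho_lt (v := v + 1) (w := v + 1 + 1) (by omega) (by omega) h2
    rw [Factors.prefixNat_succ, ih (by omega) (by omega)]
    exact hF.factorNat_of_top_lt (by omega) (by omega)
      ((hF.top_le (by omega) h2).trans_lt hp)

theorem Factors.IsChain.prefixNat_zero {F : Factors} {n : ℕ} (hF : F.IsChain n) {v : ℕ}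
    (h2 : v ≤ F.z) : F.prefixNat v 0 = 0 := by
  induction v with
  | zero => rfl
  | succ v ih =>
    rw [Factors.prefixNat_succ, ih (by omega), hF.factorNat_zero (by omega) h2]

/-! ### Descents and the number of factors -/

/-- The descents of a permutation of `ℕ` below `N`. -/
def natDescents (σ : Equiv.Perm ℕ) (N : ℕ) : Finset ℕ :=
  (Finset.range N).filter fun k => 1 ≤ k ∧ σ (k + 1) < σ k

theorem mem_natDescents {σ : Equiv.Perm ℕ} {N k : ℕ} :
    k ∈ natDescents σ N ↔ k < N ∧ 1 ≤ k ∧ σ (k + 1) < σ k := by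
  simp [natDescents]

theorem descents_eq_natDescents {n : ℕ} (π : Equiv.Perm (Fin n)) :
    descents π = natDescents (natPerm n π) n := by
  ext k
  rw [mem_natDescents, descents, Finset.mem_filter, Finset.mem_range]
  refine and_congr_right fun hk => ?_
  constructor
  · rintro ⟨h, hlt⟩
    refine ⟨h.1, ?_⟩
    rw [natPerm_apply _ (by omega) (by omega), natPerm_apply _ h.1 (by omega)]
    simpa using hlt
  · rintro ⟨h, hlt⟩
    refine ⟨⟨h, hk⟩, ?_⟩
    rw [natPerm_apply _ (by omega) (by omega), natPerm_apply _ h (by omega)] at hlt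
    simpa using hlt

/-- Each factor only creates a descent at its own exponent sum, because the earlier factors act
below that position. -/
theorem Factors.IsChain.prefixNat_lt {F : Factors} {n : ℕ} (hF : F.IsChain n) {k : ℕ}
    (hk : ∀ v, 1 ≤ v → v ≤ F.z → k ≠ F.rho v 1) {s : ℕ} (hs : s ≤ F.z) :
    F.prefixNat s k < F.prefixNat s (k + 1) := by
  induction s with
  | zero => exact Nat.lt_succ_self k
  | succ s ih =>
    rw [Factors.prefixNat_succ, Factors.prefixNat_succ]
    rcases lt_or_gt_of_ne (hk (s + 1) (by omega) hs) with hlt | hgt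
    · have hfix := apply_le_iff_of_fixed fun p => hF.prefixNat_of_lt (v := s) (p := p) hs
      exact hF.strictMonoOn_Iic (by omega) hs (Set.mem_Iic.2 ((hfix _).2 hlt.le))
        (Set.mem_Iic.2 ((hfix _).2 hlt)) (ih (by omega))
    · rw [hF.prefixNat_of_lt hs hgt, hF.prefixNat_of_lt hs (by omega)]
      exact hF.strictMonoOn_Ioi (by omega) hs (Set.mem_Ioi.2 hgt) (Set.mem_Ioi.2 (by omega))
        (Nat.lt_succ_self k)

theorem Factors.IsFactorization.descents_subset {n : ℕ} {F : Factors} {π : Equiv.Perm (Fin n)}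
    (hF : F.IsFactorization n π) :
    descents π ⊆ (Finset.Icc 1 F.z).image fun v => F.rho v 1 := by
  obtain ⟨hc, hp⟩ := Factors.isFactorization_iff.1 hF
  intro k hk
  rw [descents_eq_natDescents, ← hp, mem_natDescents] at hk
  by_contra hnot
  have := hc.prefixNat_lt (k := k) (fun v h1 h2 h => hnot (Finset.mem_image.2
    ⟨v, Finset.mem_Icc.2 ⟨h1, h2⟩, h.symm⟩)) le_rfl
  omega

theorem Factors.IsChain.card_image_rho {F : Factors} {n : ℕ} (hF : F.IsChain n) :
    ((Finset.Icc 1 F.z).image fun v => F.rho v 1).card = F.z := by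
  rw [Finset.card_image_of_injOn, Nat.card_Icc, Nat.add_sub_cancel]
  intro v hv w hw hvw
  simp only [Finset.coe_Icc, Set.mem_Icc] at hv hw
  rcases lt_trichotomy v w with h | h | h
  · exact absurd hvw (hF.rho_lt hv.1 h hw.2).ne
  · exact h
  · exact absurd hvw (hF.rho_lt hw.1 h hv.2).ne'

theorem Factors.IsFactorization.card_descents_le {n : ℕ} {F : Factors} {π : Equiv.Perm (Fin n)}
    (hF : F.IsFactorization n π) : (descents π).card ≤ F.z :=
  (Finset.card_le_card hF.descents_subset).trans_eq
    (Factors.isFactorization_iff.1 hF).1.card_image_rho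

/-! ### Existence of a factorization with one factor per descent -/

theorem exists_sorting (σ : Equiv.Perm ℕ) (d : ℕ) :
    ∃ ν : Equiv.Perm ℕ, (∀ p, ¬ (1 ≤ p ∧ p ≤ d) → ν p = p) ∧
      StrictMonoOn (fun p => σ (ν p)) (Set.Icc 1 d) := by
  let f : Fin d → ℕ := fun i => σ (i.1 + 1)
  refine ⟨natPerm d (Tuple.sort f), fun p hp => natPerm_apply_of_not _ hp, ?_⟩
  have hmono : StrictMono (f ∘ Tuple.sort f) := by
    refine (Tuple.monotone_sort f).strictMono_of_injective ?_
    refine Function.Injective.comp (fun a b h => ?_) (Tuple.sort f).injective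
    have := σ.injective h
    exact Fin.ext (by omega)
  intro p hp q hq hpq
  simp only
  rw [natPerm_apply _ hp.1 hp.2, natPerm_apply _ hq.1 hq.2]
  refine hmono (a := ⟨p - 1, _⟩) (b := ⟨q - 1, _⟩) ?_
  rw [Fin.lt_def]
  have := hp.1
  simp only
  omega

theorem perm_eq_one_of_strictMono {u : Equiv.Perm ℕ} (hu : StrictMono u) : u = 1 := by
  have hinv : StrictMono u.symm := fun a b hab => by
    rw [← hu.lt_iff_lt, Equiv.apply_symm_apply, Equiv.apply_symm_apply]
    exact hab
  ext p
  have h1 := hu.le_apply (x := p)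
  have h2 := hinv.le_apply (x := u p)
  rw [Equiv.symm_apply_apply] at h2
  exact le_antisymm h2 h1

theorem perm_eq_of_strictMonoOn_Ioi {W W' : Equiv.Perm ℕ} {d : ℕ} (h : ∀ p ≤ d, W p = W' p)
    (hW : StrictMonoOn W (Set.Ioi d)) (hW' : StrictMonoOn W' (Set.Ioi d)) : W = W' := by
  have hfix : ∀ p ≤ d, (W'⁻¹ * W) p = p := fun p hp => by
    rw [Equiv.Perm.mul_apply, h p hp, perm_inv_apply]
  have hgt : ∀ p, d < p → d < (W'⁻¹ * W) p := fun p hp => by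
    by_contra hle
    have := (W'⁻¹ * W).injective (hfix _ (not_lt.1 hle))
    omega
  have happ : ∀ p, W' ((W'⁻¹ * W) p) = W p := fun p => by
    rw [Equiv.Perm.mul_apply, perm_apply_inv]
  have hu : StrictMono (W'⁻¹ * W) := by
    intro p q hpq
    by_cases hq : q ≤ d
    · rwa [hfix p (by omega), hfix q hq]
    · by_cases hp : p ≤ d
      · rw [hfix p hp]
        exact hp.trans_lt (hgt q (by omega))
      · rw [← hW'.lt_iff_lt (hgt p (by omega)) (hgt q (by omega)), happ, happ]
        exact hW (Set.mem_Ioi.2 (by omega)) (Set.mem_Ioi.2 (by omega)) hpq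
  have := perm_eq_one_of_strictMono hu
  rw [inv_mul_eq_one] at this
  exact this.symm

/-- Run-length encoding of a nonempty weakly increasing sequence `φ 1 ≤ ⋯ ≤ φ d`: its distinct
values `h 1 < ⋯ < h m` and their multiplicities `i 1, …, i m`. -/
theorem exists_runLength (φ : ℕ → ℕ) (d : ℕ) (hd : 1 ≤ d)
    (hφ : ∀ p, 1 ≤ p → p < d → φ p ≤ φ (p + 1)) :
    ∃ (m : ℕ) (h i : ℕ → ℕ), 1 ≤ m ∧ (∀ j, 1 ≤ j → j ≤ m → 0 < i j) ∧
      (∀ j, 1 ≤ j → j < m → h j < h (j + 1)) ∧ ∑ x ∈ Finset.Icc 1 m, i x = d ∧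
      ∀ j, 1 ≤ j → j ≤ m → ∀ p, ∑ x ∈ Finset.Icc 1 (j - 1), i x < p →
        p ≤ ∑ x ∈ Finset.Icc 1 j, i x → h j = φ p := by
  induction d, hd using Nat.le_induction with
  | base =>
    refine ⟨1, fun _ => φ 1, fun _ => 1, le_rfl, fun _ _ _ => one_pos, fun _ _ _ => by omega,
      by simp, ?_⟩
    intro j hj1 hj2 p hp1 hp2
    simp at hp1 hp2
    obtain rfl : p = 1 := by omega
    rfl
  | succ d hd ih =>
    obtain ⟨m, h, i, hm, hi, hh, hsum, hb⟩ := ih fun p h1 h2 => hφ p h1 (by omega)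
    have hlast : h m = φ d := by
      obtain ⟨k, rfl⟩ : ∃ k, m = k + 1 := ⟨m - 1, by omega⟩
      have := hi (k + 1) (by omega) le_rfl
      refine hb _ hm le_rfl d ?_ hsum.ge
      rw [sum_Icc_one_succ] at hsum
      simp only [Nat.add_sub_cancel]
      omega
    have hupd : ∀ (a b j : ℕ), j < a →
        ∑ x ∈ Finset.Icc 1 j, Function.update i a b x = ∑ x ∈ Finset.Icc 1 j, i x := by
      intro a b j hj
      refine Finset.sum_congr rfl fun x hx => ?_
      rw [Finset.mem_Icc] at hx
      rw [Function.update_of_ne (by omega)]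
    by_cases heq : φ (d + 1) = φ d
    · -- the last run becomes longer
      have htop : ∑ x ∈ Finset.Icc 1 m, Function.update i m (i m + 1) x = d + 1 := by
        obtain ⟨k, rfl⟩ : ∃ k, m = k + 1 := ⟨m - 1, by omega⟩
        rw [sum_Icc_one_succ, hupd _ _ _ (by omega), Function.update_self]
        rw [sum_Icc_one_succ] at hsum
        omega
      refine ⟨m, h, Function.update i m (i m + 1), hm, ?_, hh, htop, ?_⟩
      · intro j hj1 hj2
        by_cases hjm : j = m
        · rw [hjm, Function.update_self]
          omega
        · rw [Function.update_of_ne hjm]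
          exact hi j hj1 hj2
      · intro j hj1 hj2 p hp1 hp2
        rw [hupd _ _ _ (by omega)] at hp1
        by_cases hjm : j = m
        · subst hjm
          rw [htop] at hp2
          by_cases hpd : p = d + 1
          · rw [hpd, heq, hlast]
          · exact hb j hj1 hj2 p hp1 (by omega)
        · rw [hupd _ _ _ (by omega)] at hp2
          exact hb j hj1 hj2 p hp1 hp2
    · -- a new run of length one begins
      have htop : ∑ x ∈ Finset.Icc 1 (m + 1), Function.update i (m + 1) 1 x = d + 1 := by
        rw [sum_Icc_one_succ, hupd _ _ _ (by omega), Function.update_self, hsum]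
      refine ⟨m + 1, Function.update h (m + 1) (φ (d + 1)), Function.update i (m + 1) 1,
        by omega, ?_, ?_, htop, ?_⟩
      · intro j hj1 hj2
        by_cases hjm : j = m + 1
        · rw [hjm, Function.update_self]
          omega
        · rw [Function.update_of_ne hjm]
          exact hi j hj1 (by omega)
      · intro j hj1 hj2
        rw [Function.update_of_ne (by omega)]
        by_cases hjm : j = m
        · rw [hjm, Function.update_self, hlast]
          exact lt_of_le_of_ne (hφ d hd (by omega)) (Ne.symm heq)
        · rw [Function.update_of_ne (by omega)]
          exact hh j hj1 (by omega)
      · intro j hj1 hj2 p hp1 hp2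
        rw [hupd _ _ _ (by omega)] at hp1
        by_cases hjm : j = m + 1
        · subst hjm
          rw [htop] at hp2
          simp only [Nat.add_sub_cancel] at hp1
          rw [Function.update_self, show p = d + 1 by omega]
        · rw [hupd _ _ _ (by omega)] at hp2
          rw [Function.update_of_ne hjm]
          exact hb j hj1 (by omega) p hp1 hp2

theorem add_le_of_strictMonoOn {W : ℕ → ℕ} {d : ℕ} (hW : StrictMonoOn W (Set.Icc 1 d)) {p q : ℕ}
    (hp : 1 ≤ p) (hpq : p ≤ q) (hq : q ≤ d) : W p + (q - p) ≤ W q := by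
  induction q, hpq using Nat.le_induction with
  | base => simp
  | succ q hpq ih =>
    have h1 := ih (by omega)
    have h2 := hW (a := q) (b := q + 1) ⟨by omega, by omega⟩ ⟨by omega, hq⟩ (by omega)
    omega

/-- A permutation whose only descent is `d` is an elementary word of exponent sum `d`: its letters
are the `t_{W(p) - p + d}` for `1 ≤ p ≤ d`. -/
theorem exists_elementaryWord {N d : ℕ} {W : Equiv.Perm ℕ}
    (hfix : ∀ p, ¬ (1 ≤ p ∧ p ≤ N) → W p = p) (hd : 1 ≤ d) (hdN : d < N)
    (h1 : StrictMonoOn W (Set.Icc 1 d)) (h2 : StrictMonoOn W (Set.Ioi d))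
    (hdes : W (d + 1) < W d) :
    ∃ (m : ℕ) (h i : ℕ → ℕ), IsElementaryWord N m h i ∧ ∑ x ∈ Finset.Icc 1 m, i x = d ∧
      wordPerm h i m = W := by
  have hW0 : W 0 = 0 := hfix 0 (by omega)
  have hWN : W d ≤ N := (apply_le_iff_of_fixed (fun p hp => hfix p (by omega)) d).2 hdN.le
  have hWge : ∀ p, 1 ≤ p → p ≤ d → p ≤ W p := by
    intro p hp1 hp2
    have h3 := add_le_of_strictMonoOn h1 le_rfl hp1 hp2
    have h4 : W 1 ≠ 0 := fun h => by
      have := W.injective (h.trans hW0.symm)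
      omega
    omega
  have hWd : d < W d := by
    by_contra hle
    have h3 : ∀ p, 1 ≤ p → p ≤ d → W p = p := fun p hp1 hp2 => by
      have h4 := add_le_of_strictMonoOn h1 hp1 hp2 le_rfl
      have h5 := hWge p hp1 hp2
      omega
    have h4 : W (d + 1) ≠ 0 := fun h => by
      have := W.injective (h.trans hW0.symm)
      omega
    have h5 := W.injective (h3 (W (d + 1)) (by omega) (by omega))
    omega
  obtain ⟨m, h, i, hm, hi, hh, hsum, hb⟩ := exists_runLength (fun p => W p - p + d) d hd (by
    intro p hp1 hp2
    have h3 := h1 (a := p) (b := p + 1) ⟨hp1, hp2.le⟩ ⟨by omega, hp2⟩ (by omega)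
    omega)
  have hval : ∀ j, 1 ≤ j → j ≤ m → ∃ p, 1 ≤ p ∧ p ≤ d ∧ h j = W p - p + d ∧ i j ≤ p ∧
      (p = d → j = m) := by
    intro j hj1 hj2
    obtain ⟨k, rfl⟩ : ∃ k, j = k + 1 := ⟨j - 1, by omega⟩
    have h3 := hi (k + 1) hj1 hj2
    have h4 := sum_Icc_one_mono i hj2
    have h5 := sum_Icc_one_succ i k
    refine ⟨∑ x ∈ Finset.Icc 1 (k + 1), i x, by omega, by omega, ?_, by omega, ?_⟩
    · refine hb (k + 1) hj1 hj2 _ ?_ le_rfl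
      simp only [Nat.add_sub_cancel]
      omega
    · intro hpd
      by_contra hne
      have h6 := sum_Icc_one_mono i (show k + 1 + 1 ≤ m by omega)
      have h7 := hi (k + 1 + 1) (by omega) (by omega)
      rw [sum_Icc_one_succ i (k + 1)] at h6
      omega
  have hword : IsElementaryWord N m h i := by
    refine ⟨hm, ?_, ?_, ?_⟩
    · intro j hj
      rw [Finset.mem_Icc] at hj
      obtain ⟨p, hp1, hp2, hp3, hp4, hp5⟩ := hval j hj.1 hj.2
      have h3 := hWge p hp1 hp2
      have h4 := add_le_of_strictMonoOn h1 hp1 hp2 le_rfl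
      refine ⟨?_, by omega, hi j hj.1 hj.2, ?_⟩
      · by_cases hd1 : d = 1
        · obtain rfl : p = d := by omega
          omega
        · omega
      · by_cases hpd : p = d
        · subst hpd
          omega
        · omega
    · intro j hj
      rw [Finset.mem_Ico] at hj
      exact hh j hj.1 hj.2
    · obtain ⟨p, hp1, hp2, hp3, hp4, hp5⟩ := hval 1 le_rfl hm
      omega
  refine ⟨m, h, i, hword, hsum, ?_⟩
  refine perm_eq_of_strictMonoOn_Ioi (d := d) ?_ ?_ h2
  · intro p hp
    rcases Nat.eq_zero_or_pos p with rfl | hp0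
    · rw [hword.apply_zero, hW0]
    · obtain ⟨j, hj1, hj2, hp1, hp2⟩ := exists_block i m p hp0 (by omega)
      rw [hword.apply_block hj1 hj2 hp1 hp2, hb j hj1 hj2 p hp1 hp2]
      have := hWge p hp0 hp
      omega
  · have := hword.strictMonoOn_Ioi
    rwa [hsum] at this

theorem IsElementaryWord.mono {n n' m : ℕ} {h i : ℕ → ℕ} (hw : IsElementaryWord n m h i)
    (hn : n ≤ n') : IsElementaryWord n' m h i :=
  ⟨hw.1, fun j hj => ⟨(hw.2.1 j hj).1, (hw.2.1 j hj).2.1.trans hn, (hw.2.1 j hj).2.2⟩, hw.2.2⟩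

/-- The factorization `F` followed by one more factor. -/
def Factors.append (F : Factors) (m : ℕ) (h i : ℕ → ℕ) : Factors where
  z := F.z + 1
  m := Function.update F.m (F.z + 1) m
  h := Function.update F.h (F.z + 1) h
  i := Function.update F.i (F.z + 1) i

/-- Sorting the values up to the last descent `d` splits off a last factor of exponent sum `d`; what
remains acts on `{1, …, d}` and has the other descents. -/
theorem exists_chain (N : ℕ) (σ : Equiv.Perm ℕ) (hσ : ∀ p, ¬ (1 ≤ p ∧ p ≤ N) → σ p = p) :
    ∃ F : Factors, F.IsChain N ∧ F.prefixNat F.z = σ ∧ F.z = (natDescents σ N).card := by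
  induction N using Nat.strong_induction_on generalizing σ with
  | _ N IH =>
  rcases (natDescents σ N).eq_empty_or_nonempty with hempty | hne
  · refine ⟨⟨0, fun _ => 0, fun _ _ => 0, fun _ _ => 0⟩, ⟨by simp, by simp⟩, ?_, by simp [hempty]⟩
    symm
    refine perm_eq_one_of_strictMono (strictMono_nat_of_lt_succ fun k => ?_)
    by_contra hlt
    have hnot : k ∉ natDescents σ N := by simp [hempty]
    rw [mem_natDescents] at hnot
    have hne : σ (k + 1) ≠ σ k := fun h => by
      have := σ.injective h
      omega
    rcases Nat.eq_zero_or_pos k with rfl | hk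
    · rw [hσ 0 (by omega)] at hlt hne
      omega
    · have hkN : N ≤ k := by
        by_contra hkN
        exact hnot ⟨by omega, hk, by omega⟩
      rw [hσ (k + 1) (by omega)] at hlt
      have := (apply_le_iff_of_fixed (fun p (hp : k < p) => hσ p (by omega)) k).2 le_rfl
      omega
  · set d := (natDescents σ N).max' hne with hd_def
    have hd := (natDescents σ N).max'_mem hne
    rw [← hd_def] at hd
    have hd' := mem_natDescents.1 hd
    obtain ⟨hdN, hd1, hdes⟩ := hd'
    obtain ⟨ν, hν, hmono⟩ := exists_sorting σ d
    have hνle := apply_le_iff_of_fixed (τ := ν) (R := d) fun p hp => hν p (by omega)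
    have hν' : ∀ p, ¬ (1 ≤ p ∧ p ≤ d) → ν⁻¹ p = p := fun p hp => by
      rw [Equiv.Perm.inv_eq_iff_eq, hν p hp]
    have hν'le := apply_le_iff_of_fixed (τ := ν⁻¹) (R := d) fun p hp => hν' p (by omega)
    have hνpos : ∀ p, 1 ≤ p → 1 ≤ ν⁻¹ p := fun p hp => by
      by_contra h0
      have := ν⁻¹.injective ((show ν⁻¹ p = 0 by omega).trans (hν' 0 (by omega)).symm)
      omega
    have hgt : StrictMonoOn (σ * ν) (Set.Ioi d) := by
      have : ∀ p, d < p → (σ * ν) p = σ p := fun p hp => by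
        rw [Equiv.Perm.mul_apply, hν p (by omega)]
      intro p hp q hq hpq
      rw [this p hp, this q hq]
      clear hq
      simp only [Set.mem_Ioi] at hp
      induction q, hpq using Nat.le_induction with
      | base =>
        by_contra hlt
        have hne' : σ (p + 1) ≠ σ p := fun h => by
          have := σ.injective h
          omega
        by_cases hpN : p < N
        · have := (natDescents σ N).le_max' p (mem_natDescents.2 ⟨hpN, by omega, by
            simp only [Nat.succ_eq_add_one] at *; omega⟩)
          omega
        · have h3 := hσ (p + 1) (by omega)
          have := (apply_le_iff_of_fixed (fun q (hq : p < q) => hσ q (by omega)) p).2 le_rfl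
          simp only [Nat.succ_eq_add_one] at *
          omega
      | succ q hpq ih =>
        refine ih.trans ?_
        by_contra hlt
        have hne' : σ (q + 1) ≠ σ q := fun h => by
          have := σ.injective h
          omega
        by_cases hqN : q < N
        · have := (natDescents σ N).le_max' q (mem_natDescents.2 ⟨hqN, by omega, by omega⟩)
          omega
        · have h3 := hσ (q + 1) (by omega)
          have := (apply_le_iff_of_fixed (fun p (hp : q < p) => hσ p (by omega)) q).2 le_rfl
          omega
    have hWd : (σ * ν) (d + 1) < (σ * ν) d := by
      have h3 : (σ * ν) (ν⁻¹ d) ≤ (σ * ν) d :=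
        hmono.monotoneOn (a := ν⁻¹ d) (b := d) ⟨hνpos d hd1, (hν'le d).2 le_rfl⟩ ⟨hd1, le_rfl⟩
          ((hν'le d).2 le_rfl)
      rw [Equiv.Perm.mul_apply, perm_apply_inv] at h3
      have h4 : (σ * ν) (d + 1) = σ (d + 1) := by
        rw [Equiv.Perm.mul_apply, hν (d + 1) (by omega)]
      omega
    obtain ⟨m, h, i, hword, hsum, hW⟩ := exists_elementaryWord (N := N) (d := d) (W := σ * ν)
      (fun p hp => by rw [Equiv.Perm.mul_apply, hν p (by omega), hσ p hp]) hd1 hdN hmono hgt hWd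
    obtain ⟨F, hF, hFp, hFz⟩ := IH d hdN ν⁻¹ hν'
    have hold : ∀ v, v ≤ F.z → (F.append m h i).m v = F.m v ∧ (F.append m h i).h v = F.h v ∧
        (F.append m h i).i v = F.i v := fun v hv =>
      ⟨Function.update_of_ne (by omega) _ _, Function.update_of_ne (by omega) _ _,
        Function.update_of_ne (by omega) _ _⟩
    have hnew : (F.append m h i).m (F.z + 1) = m ∧ (F.append m h i).h (F.z + 1) = h ∧
        (F.append m h i).i (F.z + 1) = i :=
      ⟨Function.update_self _ _ _, Function.update_self _ _ _, Function.update_self _ _ _⟩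
    refine ⟨F.append m h i, ⟨?_, ?_⟩, ?_, ?_⟩
    · intro v hv
      rw [Finset.mem_Icc] at hv
      rcases (show v ≤ F.z + 1 from hv.2).eq_or_lt with rfl | hlt
      · rw [hnew.1, hnew.2.1, hnew.2.2]
        exact hword
      · obtain ⟨h3, h4, h5⟩ := hold v (by omega)
        rw [h3, h4, h5]
        exact (hF.word hv.1 (by omega)).mono hdN.le
    · intro v hv
      rw [Finset.mem_Ico] at hv
      have hvz : v ≤ F.z := Nat.lt_succ_iff.1 hv.2
      obtain ⟨h3, h4, h5⟩ := hold v hvz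
      rw [h3, h4, Factors.rho]
      rcases hvz.eq_or_lt with rfl | hlt
      · rw [hnew.1, hnew.2.2, hsum]
        have hw := hF.word hv.1 le_rfl
        exact (hw.letter hw.1 le_rfl).2.1
      · obtain ⟨h3, h4, h5⟩ := hold (v + 1) hlt
        rw [h3, h5]
        exact hF.top_le hv.1 hlt
    · have hpre : (F.append m h i).prefixNat F.z = F.prefixNat F.z :=
        prefixProd_congr fun v hv => by
          rw [Finset.mem_Icc] at hv
          obtain ⟨h3, h4, h5⟩ := hold v hv.2
          rw [Factors.factorNat, Factors.factorNat, h3, h4, h5]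
      ext p
      rw [show (F.append m h i).z = F.z + 1 from rfl, Factors.prefixNat_succ, hpre, hFp,
        Factors.factorNat, hnew.1, hnew.2.1, hnew.2.2, hW, Equiv.Perm.mul_apply,
        perm_apply_inv]
    · have hdd : natDescents ν⁻¹ d = (natDescents σ N).erase d := by
        ext k
        rw [Finset.mem_erase, mem_natDescents, mem_natDescents]
        have key : 1 ≤ k → k < d → (ν⁻¹ (k + 1) < ν⁻¹ k ↔ σ (k + 1) < σ k) := by
          intro hk hkd
          rw [← hmono.lt_iff_lt ⟨hνpos _ (by omega), (hν'le _).2 (by omega)⟩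
            ⟨hνpos _ hk, (hν'le _).2 hkd.le⟩]
          simp only [perm_apply_inv]
        constructor
        · rintro ⟨h3, h4, h5⟩
          exact ⟨by omega, by omega, h4, (key h4 h3).1 h5⟩
        · rintro ⟨h3, h4, h5, h6⟩
          have := (natDescents σ N).le_max' k (mem_natDescents.2 ⟨h4, h5, h6⟩)
          have hkd : k < d := by omega
          exact ⟨hkd, h5, (key h5 hkd).2 h6⟩
      rw [show (F.append m h i).z = F.z + 1 from rfl, hFz, hdd, Finset.card_erase_of_mem hd]
      have := Finset.card_pos.2 hne
      omega

theorem exists_isFactorization {n : ℕ} (π : Equiv.Perm (Fin n)) :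
    ∃ F : Factors, F.IsFactorization n π ∧ F.z = (descents π).card := by
  obtain ⟨F, h1, h2, h3⟩ := exists_chain n (natPerm n π) fun p hp => natPerm_apply_of_not π hp
  exact ⟨F, Factors.isFactorization_iff.2 ⟨h1, h2⟩, by rw [h3, descents_eq_natDescents]⟩

theorem factorCount_eq_card_descents {n : ℕ} (π : Equiv.Perm (Fin n)) :
    factorCount n π = (descents π).card := by
  obtain ⟨F, hF, hz⟩ := exists_isFactorization π
  refine le_antisymm (Nat.sInf_le ⟨F, hF, hz⟩) (le_csInf ⟨_, F, hF, rfl⟩ ?_)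
  rintro z ⟨F', hF', rfl⟩
  exact hF'.card_descents_le

theorem exists_isStandard {n : ℕ} (π : Equiv.Perm (Fin n)) :
    ∃ F : Factors, F.IsStandard n π := by
  obtain ⟨F, hF, hz⟩ := exists_isFactorization π
  exact ⟨F, hF, hz.trans (factorCount_eq_card_descents π).symm⟩

theorem Factors.IsStandard.descents_eq {n : ℕ} {F : Factors} {π : Equiv.Perm (Fin n)}
    (hF : F.IsStandard n π) : descents π = (Finset.Icc 1 F.z).image fun v => F.rho v 1 := by
  refine Finset.eq_of_subset_of_card_le hF.1.descents_subset ?_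
  rw [(Factors.isFactorization_iff.1 hF.1).1.card_image_rho, hF.2, factorCount_eq_card_descents]

/-- The exponent sum of an elementary word is its only descent. -/
theorem Factors.IsFactorization.majorIndex_factorPerm {n : ℕ} {F : Factors}
    {π : Equiv.Perm (Fin n)} (hF : F.IsFactorization n π) {v : ℕ} (h1 : 1 ≤ v) (h2 : v ≤ F.z) :
    majorIndex (F.factorPerm n v) = F.rho v 1 := by
  have hc := (Factors.isFactorization_iff.1 hF).1
  have hw := hc.word h1 h2
  have hbelow := hc.strictMonoOn_Iic h1 h2
  have habove := hc.strictMonoOn_Ioi h1 h2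
  have htop := hc.rho_lt_top h1 h2
  have hn := (hw.letter hw.1 le_rfl).2.1
  suffices h : descents (F.factorPerm n v) = {F.rho v 1} by
    rw [majorIndex, h, Finset.sum_singleton]
  rw [descents_eq_natDescents, Factors.natPerm_factorPerm F hw]
  ext k
  rw [mem_natDescents, Finset.mem_singleton]
  constructor
  · rintro ⟨hk1, hk2, hk3⟩
    by_contra hne
    rcases lt_or_gt_of_ne hne with hlt | hgt
    · have := hbelow (a := k) (b := k + 1) hlt.le hlt (by omega)
      omega
    · have := habove (a := k) (b := k + 1) hgt (Set.mem_Ioi.2 (by omega)) (by omega)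
      omega
  · rintro rfl
    refine ⟨by omega, hw.sum_pos, ?_⟩
    -- otherwise the word would be increasing, hence the identity, yet it sends its exponent sum
    -- to the last index
    by_contra hlt
    have hmono : StrictMono (F.factorNat v) := strictMono_nat_of_lt_succ fun k => by
      rcases lt_trichotomy k (F.rho v 1) with h | h | h
      · exact hbelow (a := k) (b := k + 1) h.le h (by omega)
      · rw [h]
        refine lt_of_le_of_ne (not_lt.1 hlt) fun he => ?_
        have := (F.factorNat v).injective he
        omega
      · exact habove (a := k) (b := k + 1) h (Set.mem_Ioi.2 (by omega)) (by omega)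
    have hone := perm_eq_one_of_strictMono hmono
    have hval := hw.apply_block (j := F.m v) (p := F.rho v 1) hw.1 le_rfl
      (hw.sum_lt (by have := hw.1; omega) le_rfl) le_rfl
    rw [Factors.factorNat] at hone
    rw [hone, Equiv.Perm.one_apply] at hval
    rw [Factors.rho] at *
    omega

/-! ### The exponents of the canonical form -/

/-- The number of positions `1 ≤ x ≤ k` whose value under `σ` is at most `y`. -/
def rankLE (σ : Equiv.Perm ℕ) (k y : ℕ) : ℕ :=
  ((Finset.Icc 1 k).filter fun x => σ x ≤ y).card

theorem rankLE_succ (σ : Equiv.Perm ℕ) (k y : ℕ) :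
    rankLE σ (k + 1) y = rankLE σ k y + if σ (k + 1) ≤ y then 1 else 0 := by
  rw [rankLE, Finset.card_filter, sum_Icc_one_succ, ← Finset.card_filter]
  rfl

theorem rankLE_le (σ : Equiv.Perm ℕ) (k y : ℕ) : rankLE σ k y ≤ k := by
  simpa [rankLE] using Finset.card_filter_le (Finset.Icc 1 k) fun x => σ x ≤ y

theorem rankLE_mono (σ : Equiv.Perm ℕ) (k : ℕ) {y y' : ℕ} (h : y ≤ y') :
    rankLE σ k y ≤ rankLE σ k y' :=
  Finset.card_le_card (Finset.monotone_filter_right _ fun _ _ hx => le_trans hx h)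

theorem rankLE_lt (σ : Equiv.Perm ℕ) {k y i : ℕ} (h1 : 1 ≤ i) (h2 : i ≤ k) (h : y < σ i) :
    rankLE σ k y < rankLE σ k (σ i) := by
  refine Finset.card_lt_card (Finset.ssubset_iff_of_subset
    (Finset.monotone_filter_right _ fun _ _ hx => le_trans hx h.le) |>.2 ⟨i, ?_, ?_⟩)
  · simp [h1, h2]
  · simp [h]

/-- The `k`-th term of the Lehmer code of `σ`, for `k ≥ 1`: the number of positions `1 ≤ i < k`
with `σ i > σ k`, expressed through the positions with the opposite inequality. -/
def lehmer (σ : Equiv.Perm ℕ) (k : ℕ) : ℕ := k - rankLE σ k (σ k)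

/-- The exponent of `t_k` in the canonical form of `σ`: the number of positions `i < k` with `σ i`
in the cyclic open interval from `σ k` to `σ (k + 1)`. -/
def canonicalExp (σ : Equiv.Perm ℕ) (k : ℕ) : ℕ :=
  if σ (k + 1) < σ k then rankLE σ k (σ (k + 1)) + k - rankLE σ k (σ k)
  else rankLE σ k (σ (k + 1)) - rankLE σ k (σ k)

theorem rankLE_self_succ (σ : Equiv.Perm ℕ) (k : ℕ) :
    rankLE σ (k + 1) (σ (k + 1)) = rankLE σ k (σ (k + 1)) + 1 := by
  rw [rankLE_succ, if_pos le_rfl]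

theorem canonicalExp_of_lt {σ : Equiv.Perm ℕ} {k : ℕ} (h : σ k < σ (k + 1)) :
    canonicalExp σ k + lehmer σ (k + 1) = lehmer σ k := by
  have h1 := rankLE_mono σ k h.le
  have h2 := rankLE_le σ k (σ (k + 1))
  rw [canonicalExp, if_neg (by omega), lehmer, lehmer, rankLE_self_succ]
  omega

theorem canonicalExp_of_gt {σ : Equiv.Perm ℕ} {k : ℕ} (h : σ (k + 1) < σ k) :
    canonicalExp σ k + lehmer σ (k + 1) = k + lehmer σ k := by
  have h1 := rankLE_le σ k (σ k)
  have h2 := rankLE_le σ k (σ (k + 1))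
  rw [canonicalExp, if_pos h, lehmer, lehmer, rankLE_self_succ]
  omega

theorem canonicalExp_lt (σ : Equiv.Perm ℕ) {k : ℕ} (hk : 1 ≤ k) : canonicalExp σ k < k := by
  have h2 := rankLE_le σ k (σ (k + 1))
  have h3 : 0 < rankLE σ k (σ k) := by
    obtain ⟨j, rfl⟩ : ∃ j, k = j + 1 := ⟨k - 1, by omega⟩
    rw [rankLE_self_succ]
    omega
  rw [canonicalExp]
  split_ifs with h
  · have := rankLE_lt σ hk le_rfl h
    omega
  · omega

/-- The partial product `t_1^{e_1} ⋯ t_k^{e_k}` sends `i ≤ k` to the rank of `σ i` among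
`σ 1, …, σ k` in the cyclic order that starts at `σ (k + 1)`. -/
theorem prefixProd_canonicalExp (σ : Equiv.Perm ℕ) (k : ℕ) :
    (∀ i, ¬ (1 ≤ i ∧ i ≤ k) → prefixProd (fun k => tNat k ^ canonicalExp σ k) k i = i) ∧
    ∀ i, 1 ≤ i → i ≤ k →
      prefixProd (fun k => tNat k ^ canonicalExp σ k) k i + rankLE σ k (σ (k + 1)) =
        rankLE σ k (σ i) + if σ i < σ (k + 1) then k else 0 := by
  induction k with
  | zero => exact ⟨fun i _ => rfl, fun i h1 h2 => by omega⟩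
  | succ k ih =>
    obtain ⟨ih1, ih2⟩ := ih
    have hlt := canonicalExp_lt σ (k := k + 1) (by omega)
    have hT : ∀ p, prefixProd (fun k => tNat k ^ canonicalExp σ k) (k + 1) p = _ := fun p =>
      tNat_pow_apply (p := prefixProd (fun k => tNat k ^ canonicalExp σ k) k p)
        (show 1 ≤ k + 1 by omega) hlt.le
    refine ⟨fun i hi => ?_, fun i h1 h2 => ?_⟩
    · rw [hT, ih1 i (by omega), if_neg hi]
    have hne : σ i ≠ σ (k + 1 + 1) := fun h => by
      have := σ.injective h
      omega
    have hc := rankLE_self_succ σ k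
    have hd1 := rankLE_le σ (k + 1) (σ (k + 1 + 1))
    have hd2 := rankLE_le σ k (σ (k + 1))
    -- ranks compare as values do
    have hri : σ i ≤ σ (k + 1 + 1) → rankLE σ (k + 1) (σ i) ≤ rankLE σ (k + 1) (σ (k + 1 + 1)) :=
      rankLE_mono σ (k + 1)
    have hri' : σ (k + 1 + 1) < σ i → rankLE σ (k + 1) (σ (k + 1 + 1)) < rankLE σ (k + 1) (σ i) :=
      rankLE_lt σ h1 h2
    have hrk : σ (k + 1) ≤ σ (k + 1 + 1) →
        rankLE σ (k + 1) (σ (k + 1)) ≤ rankLE σ (k + 1) (σ (k + 1 + 1)) := rankLE_mono σ (k + 1)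
    have hrk' : σ (k + 1 + 1) < σ (k + 1) →
        rankLE σ (k + 1) (σ (k + 1 + 1)) < rankLE σ (k + 1) (σ (k + 1)) :=
      rankLE_lt σ (by omega) le_rfl
    have hr1 := rankLE_le σ (k + 1) (σ i)
    rcases h2.eq_or_lt with rfl | h2
    · rw [hT, ih1 (k + 1) (by omega), canonicalExp]
      split_ifs <;> omega
    · have hnek : σ i ≠ σ (k + 1) := fun h => by
        have := σ.injective h
        omega
      have hi := ih2 i h1 (by omega)
      have hs := rankLE_succ σ k (σ i)
      have hik : σ i ≤ σ (k + 1) → rankLE σ k (σ i) ≤ rankLE σ k (σ (k + 1)) := rankLE_mono σ k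
      have hik' : σ (k + 1) < σ i → rankLE σ k (σ (k + 1)) < rankLE σ k (σ i) :=
        rankLE_lt σ h1 (by omega)
      have hpos : 1 ≤ rankLE σ k (σ i) := Finset.card_pos.2 ⟨i, by simp; omega⟩
      rw [hT, canonicalExp]
      generalize prefixProd (fun k => tNat k ^ canonicalExp σ k) k i = R at *
      split_ifs at * <;> omega

theorem rankLE_of_fixed {σ : Equiv.Perm ℕ} {n : ℕ} (hσ : ∀ p, ¬ (1 ≤ p ∧ p ≤ n) → σ p = p)
    {y : ℕ} (hy : y ≤ n) : rankLE σ n y = y := by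
  have hle := apply_le_iff_of_fixed (R := n) fun p hp => hσ p (by omega)
  have h : ((Finset.Icc 1 n).filter fun x => σ x ≤ y).image σ = Finset.Icc 1 y := by
    ext q
    simp only [Finset.mem_image, Finset.mem_filter, Finset.mem_Icc]
    constructor
    · rintro ⟨x, ⟨⟨hx1, hx2⟩, hx3⟩, rfl⟩
      refine ⟨?_, hx3⟩
      by_contra h0
      have := σ.injective ((show σ x = 0 by omega).trans (hσ 0 (by omega)).symm)
      omega
    · rintro ⟨hq1, hq2⟩
      refine ⟨σ⁻¹ q, ⟨⟨?_, ?_⟩, ?_⟩, perm_apply_inv σ q⟩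
      · by_contra h0
        have h1 := perm_apply_inv σ q
        rw [show σ⁻¹ q = 0 by omega, hσ 0 (by omega)] at h1
        omega
      · rw [← hle, perm_apply_inv]
        omega
      · rwa [perm_apply_inv]
  have := congrArg Finset.card h
  rw [Finset.card_image_of_injective _ σ.injective, Nat.card_Icc, Nat.add_sub_cancel] at this
  exact this

theorem isCanonicalForm_canonicalExp {n : ℕ} (π : Equiv.Perm (Fin n)) :
    IsCanonicalForm n (canonicalExp (natPerm n π)) π := by
  have hσ : ∀ p, ¬ (1 ≤ p ∧ p ≤ n) → natPerm n π p = p := fun p hp => natPerm_apply_of_not π hp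
  set σ := natPerm n π with hσdef
  have h1 : canonicalExp σ 1 = 0 := by
    have := canonicalExp_lt σ (k := 1) le_rfl
    omega
  refine ⟨fun k hk => ?_, fun k hk _ => canonicalExp_lt σ (by omega), ?_⟩
  · by_contra hk'
    apply hk
    rcases (show k = 0 ∨ k = 1 ∨ n < k by omega) with rfl | rfl | hk
    · simp [canonicalExp, rankLE]
    · exact h1
    · have h2 := hσ k (by omega)
      have h3 := hσ (k + 1) (by omega)
      have h4 := rankLE_of_fixed (n := k) (fun p hp => hσ p (by omega)) le_rfl
      have h5 := rankLE_le σ k (k + 1)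
      rw [canonicalExp, h2, h3, if_neg (by omega), h4]
      omega
  · rcases Nat.eq_zero_or_pos n with rfl | hn
    · exact Subsingleton.elim _ _
    apply natPerm_injective n
    rw [lrProd]
    have hlist : ((List.range' 2 (n - 1)).map fun k => tGen n k ^ canonicalExp σ k).reverse.prod =
        prefixProd (fun k => tGen n k ^ canonicalExp σ k) n := by
      rw [← reverse_prod_range']
      obtain ⟨l, rfl⟩ : ∃ l, n = l + 1 := ⟨n - 1, by omega⟩
      rw [List.range'_succ]
      simp [h1]
    rw [hlist, map_prefixProd]
    have hcongr : prefixProd (fun k => natPerm n (tGen n k ^ canonicalExp σ k)) n =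
        prefixProd (fun k => tNat k ^ canonicalExp σ k) n := by
      refine prefixProd_congr fun k hk => ?_
      rw [Finset.mem_Icc] at hk
      rw [map_pow, natPerm_tGen hk.1 hk.2]
    rw [hcongr, ← hσdef]
    obtain ⟨hout, hin⟩ := prefixProd_canonicalExp σ n
    ext p
    by_cases hp : 1 ≤ p ∧ p ≤ n
    · have h2 := hin p hp.1 hp.2
      have h3 : σ p ≤ n := (apply_le_iff_of_fixed (fun q hq => hσ q (by omega)) p).2 hp.2
      have h4 : rankLE σ n (n + 1) = n := by
        rw [rankLE, Finset.filter_true_of_mem]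
        · simp
        · intro x hx
          rw [Finset.mem_Icc] at hx
          exact ((apply_le_iff_of_fixed (fun q hq => hσ q (by omega)) x).2 hx.2).trans (by omega)
      rw [hσ (n + 1) (by omega), h4, rankLE_of_fixed hσ h3, if_pos (by omega)] at h2
      omega
    · rw [hout p hp, hσ p hp]

/-! ### The numbers `κ` as positions in the suffix products -/

namespace Factors

/-- The product of the factors `v, …, z` as a permutation of `ℕ`, for `v ≥ 1`. -/
noncomputable def suffixNat (F : Factors) (v : ℕ) : Equiv.Perm ℕ :=
  F.prefixNat F.z * (F.prefixNat (v - 1))⁻¹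

/-- The position of the value `k` in the one-line notation of the product of the factors
`v, …, z`. -/
noncomputable def pos (F : Factors) (v k : ℕ) : ℕ := (F.suffixNat v)⁻¹ k

/-- The amount `ϑ_j` by which the `v`-th factor translates the positions of its `j`-th block, as a
function of the position `y`; it is `0` outside the blocks. -/
def shift (F : Factors) (v y : ℕ) : ℕ :=
  ∑ j ∈ (Finset.Icc 1 (F.m v)).filter (fun j => F.varrho v (j - 1) < y ∧ y ≤ F.varrho v j),
    F.vartheta v j

/-- The position `y` lies in the blocks of the `v`-th factor; there is no restriction beyond the
last factor, where the suffix product is the identity. -/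
def Active (F : Factors) (v y : ℕ) : Prop := v ≤ F.z → y ≤ F.rho v 1

/-- `y` is the first position of a block of the `v`-th factor. -/
def IsStart (F : Factors) (v y : ℕ) : Prop :=
  ∃ j, 1 ≤ j ∧ j ≤ F.m v ∧ y = F.varrho v (j - 1) + 1

/-- `y` is the last position of a block of the `v`-th factor. -/
def IsEnd (F : Factors) (v y : ℕ) : Prop :=
  ∃ j, 1 ≤ j ∧ j ≤ F.m v ∧ y = F.varrho v j

theorem suffixNat_pos (F : Factors) (v k : ℕ) : F.suffixNat v (F.pos v k) = k :=
  perm_apply_inv _ _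

theorem pos_suffixNat (F : Factors) (v p : ℕ) : F.pos v (F.suffixNat v p) = p :=
  perm_inv_apply _ _

theorem pos_eq_iff (F : Factors) {v k p : ℕ} : F.pos v k = p ↔ F.suffixNat v p = k :=
  ⟨fun h => h ▸ F.suffixNat_pos v k, fun h => h ▸ F.pos_suffixNat v p⟩

theorem pos_injective (F : Factors) (v : ℕ) : Function.Injective (F.pos v) :=
  (F.suffixNat v)⁻¹.injective

theorem suffixNat_succ (F : Factors) {v : ℕ} (h1 : 1 ≤ v) (p : ℕ) :
    F.suffixNat (v + 1) (F.factorNat v p) = F.suffixNat v p := by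
  obtain ⟨w, rfl⟩ : ∃ w, v = w + 1 := ⟨v - 1, by omega⟩
  rw [suffixNat, suffixNat, Equiv.Perm.mul_apply, Equiv.Perm.mul_apply]
  congr 1
  simp only [Nat.add_sub_cancel]
  rw [Equiv.Perm.inv_eq_iff_eq, prefixNat_succ, perm_apply_inv]

theorem factorNat_pos (F : Factors) {v : ℕ} (h1 : 1 ≤ v) (k : ℕ) :
    F.factorNat v (F.pos v k) = F.pos (v + 1) k := by
  rw [eq_comm, pos_eq_iff, suffixNat_succ F h1, suffixNat_pos]

theorem suffixNat_top (F : Factors) : F.suffixNat (F.z + 1) = 1 := by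
  rw [suffixNat, Nat.add_sub_cancel, mul_inv_cancel]

theorem pos_top (F : Factors) (k : ℕ) : F.pos (F.z + 1) k = k := by
  rw [pos_eq_iff, suffixNat_top, Equiv.Perm.one_apply]

theorem pos_one (F : Factors) (k : ℕ) : F.pos 1 k = (F.prefixNat F.z)⁻¹ k := by
  rw [pos, suffixNat, Nat.sub_self, show F.prefixNat 0 = 1 from rfl, inv_one, mul_one]

theorem pos_eq_prefixNat (F : Factors) (v k : ℕ) :
    F.pos v k = F.prefixNat (v - 1) (F.pos 1 k) := by
  rw [pos_eq_iff, suffixNat, Equiv.Perm.mul_apply, perm_inv_apply, pos_one, perm_apply_inv]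

theorem active_top (F : Factors) (y : ℕ) : F.Active (F.z + 1) y := fun h => by omega

theorem shift_eq_zero_of_lt (F : Factors) {v y : ℕ} (hy : F.rho v 1 < y) : F.shift v y = 0 := by
  rw [shift, Finset.filter_false_of_mem, Finset.sum_empty]
  intro j hj h
  rw [Finset.mem_Icc] at hj
  have := sum_Icc_one_mono (F.i v) hj.2
  rw [rho_one] at hy
  simp only [varrho] at *
  omega

theorem shift_eq_of_block (F : Factors) {v j y : ℕ} (hj1 : 1 ≤ j) (hj2 : j ≤ F.m v)
    (h1 : F.varrho v (j - 1) < y) (h2 : y ≤ F.varrho v j) : F.shift v y = F.vartheta v j := by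
  rw [shift, Finset.sum_eq_single_of_mem j]
  · simp [hj1, hj2, h1, h2]
  · intro j' hj' hne
    rw [Finset.mem_filter, Finset.mem_Icc] at hj'
    exact absurd (block_unique hj'.1.1 hj1 hj'.2.1 hj'.2.2 h1 h2) hne

theorem varrho_le_rho (F : Factors) {v j : ℕ} (hj : j ≤ F.m v) :
    F.varrho v j ≤ F.rho v 1 :=
  sum_Icc_one_mono (F.i v) hj

theorem exists_block (F : Factors) {v y : ℕ} (hy : 1 ≤ y) (hy2 : y ≤ F.rho v 1) :
    ∃ j, 1 ≤ j ∧ j ≤ F.m v ∧ F.varrho v (j - 1) < y ∧ y ≤ F.varrho v j :=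
  OGS.exists_block (F.i v) (F.m v) y hy hy2

theorem pos_eq_of_factorNat_eq (F : Factors) {v k y : ℕ} (h1 : 1 ≤ v)
    (h : F.factorNat v y = F.pos (v + 1) k) : F.pos v k = y := by
  rw [← F.factorNat_pos h1] at h
  exact ((F.factorNat v).injective h).symm

theorem isEnd_of_isStart_succ (F : Factors) {v y : ℕ} (hy : 1 ≤ y)
    (h : F.IsStart v (y + 1)) : F.IsEnd v y := by
  obtain ⟨j, hj1, hj2, h⟩ := h
  have hj : j ≠ 1 := by
    rintro rfl
    simp [varrho] at h
    omega
  exact ⟨j - 1, by omega, by omega, by omega⟩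

theorem not_isEnd_of_not_isStart_succ (F : Factors) {v y : ℕ} (hy2 : y + 1 ≤ F.rho v 1)
    (h : ¬ F.IsStart v (y + 1)) : ¬ F.IsEnd v y := by
  rintro ⟨j, hj1, hj2, rfl⟩
  rcases hj2.eq_or_lt with rfl | hlt
  · rw [rho_one] at hy2
    omega
  · exact h ⟨j + 1, by omega, hlt, rfl⟩

namespace IsChain

variable {F : Factors} {n : ℕ}

theorem varrho_lt (hF : F.IsChain n) {v j j' : ℕ} (h1 : 1 ≤ v) (h2 : v ≤ F.z) (hjj : j < j')
    (hj : j' ≤ F.m v) : F.varrho v j < F.varrho v j' :=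
  (hF.word h1 h2).sum_lt hjj hj

theorem varrho_inj (hF : F.IsChain n) {v j j' : ℕ} (h1 : 1 ≤ v) (h2 : v ≤ F.z) (hj : j ≤ F.m v)
    (hj' : j' ≤ F.m v) (h : F.varrho v j = F.varrho v j') : j = j' := by
  rcases lt_trichotomy j j' with hlt | heq | hgt
  · have := hF.varrho_lt h1 h2 hlt hj'
    omega
  · exact heq
  · have := hF.varrho_lt h1 h2 hgt hj
    omega

theorem vartheta_lt (hF : F.IsChain n) {v j j' : ℕ} (h1 : 1 ≤ v) (h2 : v ≤ F.z) (hj : 1 ≤ j)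
    (hjj : j < j') (hj' : j' ≤ F.m v) : F.vartheta v j < F.vartheta v j' := by
  have hw := hF.word h1 h2
  have h3 := hw.h_lt hj hjj hj'
  have h4 := hw.h_le le_rfl hj (by omega)
  have h5 : F.rho v 1 ≤ F.h v 1 := hw.2.2.2
  rw [vartheta, vartheta]
  omega

theorem factorNat_eq (hF : F.IsChain n) {v y : ℕ} (h1 : 1 ≤ v) (h2 : v ≤ F.z) (hy : 1 ≤ y)
    (hy2 : y ≤ F.rho v 1) : F.factorNat v y = y + F.shift v y := by
  obtain ⟨j, hj1, hj2, h3, h4⟩ := F.exists_block hy hy2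
  rw [F.shift_eq_of_block hj1 hj2 h3 h4]
  exact (hF.word h1 h2).apply_block hj1 hj2 h3 h4

theorem active_factorNat (hF : F.IsChain n) {v y : ℕ} (h1 : 1 ≤ v) (h2 : v ≤ F.z)
    (hy : y ≤ F.rho v 1) : F.Active (v + 1) (F.factorNat v y) := fun h => by
  have h3 := hF.rho_lt_top h1 h2
  have h4 := (apply_le_iff_of_fixed (fun p hp => hF.factorNat_of_top_lt h1 h2 hp) y).2
    (hy.trans h3.le)
  exact h4.trans (hF.top_le h1 h)

theorem active_succ (hF : F.IsChain n) {v k : ℕ} (h1 : 1 ≤ v) (h2 : v ≤ F.z)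
    (hk : F.pos v k ≤ F.rho v 1) : F.Active (v + 1) (F.pos (v + 1) k) := by
  rw [← F.factorNat_pos h1]
  exact hF.active_factorNat h1 h2 hk

theorem suffixNat_zero (hF : F.IsChain n) {v : ℕ} (h2 : v ≤ F.z + 1) :
    F.suffixNat v 0 = 0 := by
  have h3 : (F.prefixNat (v - 1))⁻¹ 0 = 0 := by
    rw [Equiv.Perm.inv_eq_iff_eq, hF.prefixNat_zero (by omega)]
  rw [suffixNat, Equiv.Perm.mul_apply, h3, hF.prefixNat_zero le_rfl]

theorem pos_pos (hF : F.IsChain n) {v k : ℕ} (h2 : v ≤ F.z + 1) (hk : 1 ≤ k) :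
    1 ≤ F.pos v k := by
  by_contra h0
  have h3 := (F.pos_eq_iff (v := v) (k := k) (p := 0)).1 (by omega)
  rw [hF.suffixNat_zero h2] at h3
  omega

end IsChain

/-- Induction on the index of a factor from the last one down to the first. -/
theorem downward_induction {P : ℕ → Prop} {z : ℕ} (base : P (z + 1))
    (step : ∀ v, 1 ≤ v → v ≤ z → P (v + 1) → P v) {v : ℕ} (h1 : 1 ≤ v) (h2 : v ≤ z + 1) : P v := by
  obtain ⟨d, hd⟩ : ∃ d, v + d = z + 1 := ⟨z + 1 - v, by omega⟩
  induction d generalizing v with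
  | zero =>
    obtain rfl : v = z + 1 := by omega
    exact base
  | succ d ih => exact step v h1 (by omega) (ih (by omega) (by omega) (by omega))

namespace IsChain

variable {F : Factors} {n : ℕ}

theorem suffixNat_lt (hF : F.IsChain n) {v : ℕ} (h1 : 1 ≤ v) (h2 : v ≤ F.z + 1) :
    ∀ x y, x < y → F.Active v y → F.suffixNat v x < F.suffixNat v y := by
  refine downward_induction (z := F.z)
    (P := fun v => ∀ x y, x < y → F.Active v y → F.suffixNat v x < F.suffixNat v y) ?_ ?_ h1 h2
  · intro x y hxy _
    rwa [suffixNat_top]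
  · intro v h1 h2 ih x y hxy hy
    have hy' := hy h2
    rw [← F.suffixNat_succ h1, ← F.suffixNat_succ h1]
    exact ih _ _ (hF.strictMonoOn_Iic h1 h2 (Set.mem_Iic.2 (hxy.le.trans hy')) hy' hxy)
      (hF.active_factorNat h1 h2 hy')

theorem suffixNat_le (hF : F.IsChain n) {v x y : ℕ} (h1 : 1 ≤ v) (h2 : v ≤ F.z + 1)
    (hxy : x ≤ y) (hy : F.Active v y) : F.suffixNat v x ≤ F.suffixNat v y := by
  rcases hxy.eq_or_lt with rfl | hlt
  · exact le_rfl
  · exact (hF.suffixNat_lt h1 h2 x y hlt hy).le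

theorem lt_of_suffixNat_lt (hF : F.IsChain n) {v x y : ℕ} (h1 : 1 ≤ v) (h2 : v ≤ F.z + 1)
    (hx : F.Active v x) (h : F.suffixNat v x < F.suffixNat v y) : x < y := by
  by_contra hle
  have := hF.suffixNat_le h1 h2 (not_lt.1 hle) hx
  omega

/-- Comparing an arbitrary value `k`, whose position is in the blocks, with the values on the
blocks amounts to comparing positions. -/
theorem pos_lt_iff (hF : F.IsChain n) {v k y : ℕ} (h1 : 1 ≤ v) (h2 : v ≤ F.z + 1)
    (hk : F.Active v (F.pos v k)) (hy : F.Active v y) : F.pos v k < y ↔ k < F.suffixNat v y := by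
  constructor
  · intro h
    have := hF.suffixNat_lt h1 h2 _ _ h hy
    rwa [suffixNat_pos] at this
  · intro h
    refine hF.lt_of_suffixNat_lt h1 h2 hk ?_
    rwa [suffixNat_pos]

theorem suffixNat_kappaPlusStep (hF : F.IsChain n) {v j : ℕ} (h1 : 1 ≤ v) (hj1 : 1 ≤ j)
    (hj2 : j ≤ F.m v) (d : ℕ) (hd : v + d ≤ F.z) :
    F.suffixNat (v + d + 1) (F.kappaPlusStep v j d) = F.suffixNat v (F.varrho v j) ∧
      1 ≤ F.kappaPlusStep v j d ∧ F.Active (v + d + 1) (F.kappaPlusStep v j d) := by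
  induction d with
  | zero =>
    have hlt := hF.varrho_lt h1 hd (show j - 1 < j by omega) hj2
    have hle := F.varrho_le_rho hj2
    have hg : F.factorNat v (F.varrho v j) = F.kappaPlusStep v j 0 := by
      rw [hF.factorNat_eq h1 hd (by omega) hle, F.shift_eq_of_block hj1 hj2 hlt le_rfl,
        kappaPlusStep, Nat.add_comm]
    refine ⟨?_, ?_, ?_⟩
    · rw [← hg]
      exact F.suffixNat_succ h1 _
    · rw [kappaPlusStep]
      omega
    · rw [← hg]
      exact hF.active_factorNat h1 hd hle
  | succ d ih =>
    obtain ⟨h3, h4, h5⟩ := ih (by omega)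
    have hg : F.factorNat (v + d + 1) (F.kappaPlusStep v j d) = F.kappaPlusStep v j (d + 1) :=
      hF.factorNat_eq (by omega) hd h4 (h5 hd)
    refine ⟨?_, ?_, ?_⟩
    · rw [← hg, ← h3]
      exact F.suffixNat_succ (by omega) _
    · rw [kappaPlusStep]
      omega
    · rw [← hg]
      exact hF.active_factorNat (by omega) hd (h5 hd)

theorem suffixNat_kappaMinusStep (hF : F.IsChain n) {v j : ℕ} (h1 : 1 ≤ v) (hj1 : 1 ≤ j)
    (hj2 : j ≤ F.m v) (d : ℕ) (hd : v + d ≤ F.z) :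
    F.suffixNat (v + d + 1) (F.kappaMinusStep v j d + 1) =
        F.suffixNat v (F.varrho v (j - 1) + 1) ∧
      F.Active (v + d + 1) (F.kappaMinusStep v j d + 1) := by
  induction d with
  | zero =>
    have hlt := hF.varrho_lt h1 hd (show j - 1 < j by omega) hj2
    have hle := F.varrho_le_rho hj2
    have hg : F.factorNat v (F.varrho v (j - 1) + 1) = F.kappaMinusStep v j 0 + 1 := by
      rw [hF.factorNat_eq h1 hd (by omega) (by omega),
        F.shift_eq_of_block hj1 hj2 (Nat.lt_succ_self _) hlt, kappaMinusStep]
      omega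
    refine ⟨?_, ?_⟩
    · rw [← hg]
      exact F.suffixNat_succ h1 _
    · rw [← hg]
      exact hF.active_factorNat h1 hd (by omega)
  | succ d ih =>
    obtain ⟨h3, h5⟩ := ih (by omega)
    have hg : F.factorNat (v + d + 1) (F.kappaMinusStep v j d + 1) =
        F.kappaMinusStep v j (d + 1) + 1 := by
      rw [hF.factorNat_eq (v := v + d + 1) (by omega) hd (by omega) (h5 hd), kappaMinusStep, shift]
      simp only [Nat.lt_succ_iff, Nat.succ_le_iff]
      omega
    refine ⟨?_, ?_⟩
    · rw [← hg, ← h3]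
      exact F.suffixNat_succ (by omega) _
    · rw [← hg]
      exact hF.active_factorNat (by omega) hd (h5 hd)

theorem kappaPlus_eq (hF : F.IsChain n) {v j : ℕ} (h1 : 1 ≤ v) (h2 : v ≤ F.z) (hj1 : 1 ≤ j)
    (hj2 : j ≤ F.m v) : F.kappaPlus v j = F.suffixNat v (F.varrho v j) := by
  have h3 := (hF.suffixNat_kappaPlusStep h1 hj1 hj2 (F.z - v) (by omega)).1
  rw [show v + (F.z - v) + 1 = F.z + 1 by omega, suffixNat_top] at h3
  exact h3

theorem kappaMinus_add_one (hF : F.IsChain n) {v j : ℕ} (h1 : 1 ≤ v) (h2 : v ≤ F.z)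
    (hj1 : 1 ≤ j) (hj2 : j ≤ F.m v) :
    F.kappaMinus v j + 1 = F.suffixNat v (F.varrho v (j - 1) + 1) := by
  have h3 := (hF.suffixNat_kappaMinusStep h1 hj1 hj2 (F.z - v) (by omega)).1
  rw [show v + (F.z - v) + 1 = F.z + 1 by omega, suffixNat_top] at h3
  exact h3

theorem kappaPlus_eq_iff (hF : F.IsChain n) {v j k : ℕ} (h1 : 1 ≤ v) (h2 : v ≤ F.z)
    (hj1 : 1 ≤ j) (hj2 : j ≤ F.m v) : F.kappaPlus v j = k ↔ F.pos v k = F.varrho v j := by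
  rw [hF.kappaPlus_eq h1 h2 hj1 hj2, pos_eq_iff]

theorem kappaMinus_eq_iff (hF : F.IsChain n) {v j k : ℕ} (h1 : 1 ≤ v) (h2 : v ≤ F.z)
    (hj1 : 1 ≤ j) (hj2 : j ≤ F.m v) :
    F.kappaMinus v j = k ↔ F.pos v (k + 1) = F.varrho v (j - 1) + 1 := by
  rw [pos_eq_iff, ← hF.kappaMinus_add_one h1 h2 hj1 hj2]
  omega

/-! ### Positions of the values `k` and `k + 1` -/

theorem le_rho_of_isStart (hF : F.IsChain n) {v y : ℕ} (h1 : 1 ≤ v) (h2 : v ≤ F.z)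
    (hy : F.IsStart v y) : 1 ≤ y ∧ y ≤ F.rho v 1 := by
  obtain ⟨j, hj1, hj2, rfl⟩ := hy
  have := hF.varrho_lt h1 h2 (show j - 1 < j by omega) hj2
  have := F.varrho_le_rho hj2
  omega

theorem le_rho_of_isEnd (hF : F.IsChain n) {v y : ℕ} (h1 : 1 ≤ v) (h2 : v ≤ F.z)
    (hy : F.IsEnd v y) : 1 ≤ y ∧ y ≤ F.rho v 1 := by
  obtain ⟨j, hj1, hj2, rfl⟩ := hy
  have := hF.varrho_lt h1 h2 (show j - 1 < j by omega) hj2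
  have := F.varrho_le_rho hj2
  omega

/-- Inside a block, neighbouring positions have neighbouring images. -/
theorem factorNat_succ_of_not_isEnd (hF : F.IsChain n) {v y : ℕ} (h1 : 1 ≤ v) (h2 : v ≤ F.z)
    (hy : 1 ≤ y) (hy2 : y ≤ F.rho v 1) (h : ¬ F.IsEnd v y) :
    y + 1 ≤ F.rho v 1 ∧ F.shift v (y + 1) = F.shift v y ∧
      F.factorNat v (y + 1) = F.factorNat v y + 1 := by
  obtain ⟨j, hj1, hj2, h3, h4⟩ := F.exists_block hy hy2
  have h5 : y ≠ F.varrho v j := fun h' => h ⟨j, hj1, hj2, h'⟩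
  have h6 := F.varrho_le_rho hj2
  have h7 : F.shift v (y + 1) = F.shift v y := by
    rw [F.shift_eq_of_block hj1 hj2 h3 h4, F.shift_eq_of_block hj1 hj2 (by omega) (by omega)]
  refine ⟨by omega, h7, ?_⟩
  rw [hF.factorNat_eq h1 h2 hy hy2, hF.factorNat_eq h1 h2 (by omega) (by omega), h7]
  omega

/-- A position inside a block that does not start it has its predecessor in the same block. -/
theorem exists_pred_of_not_isStart (hF : F.IsChain n) {v y : ℕ} (h1 : 1 ≤ v) (h2 : v ≤ F.z)
    (hy : 1 ≤ y) (hle : y ≤ F.rho v 1) (h : ¬ F.IsStart v y) :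
    ∃ x, y = x + 1 ∧ 1 ≤ x ∧ ¬ F.IsEnd v x ∧ F.factorNat v y = F.factorNat v x + 1 := by
  obtain ⟨x, rfl⟩ : ∃ x, y = x + 1 := ⟨y - 1, by omega⟩
  have hx : 1 ≤ x := by
    by_contra h0
    obtain rfl : x = 0 := by omega
    exact h ⟨1, le_rfl, (hF.word h1 h2).1, by simp [varrho]⟩
  have hne := F.not_isEnd_of_not_isStart_succ hle h
  exact ⟨x, rfl, hx, hne, (hF.factorNat_succ_of_not_isEnd h1 h2 hx (by omega) hne).2.2⟩

/-- Between two blocks the images jump by at least two. -/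
theorem factorNat_succ_of_isEnd (hF : F.IsChain n) {v y : ℕ} (h1 : 1 ≤ v) (h2 : v ≤ F.z)
    (hy2 : y + 1 ≤ F.rho v 1) (h : F.IsEnd v y) :
    F.factorNat v y + 1 < F.factorNat v (y + 1) := by
  have hy := hF.le_rho_of_isEnd h1 h2 h
  rw [hF.factorNat_eq h1 h2 hy.1 hy.2, hF.factorNat_eq h1 h2 (by omega) hy2]
  obtain ⟨j, hj1, hj2, rfl⟩ := h
  have hjm : j < F.m v := by
    refine lt_of_le_of_ne hj2 ?_
    rintro rfl
    rw [rho_one] at hy2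
    omega
  have h3 := hF.varrho_lt h1 h2 (show j - 1 < j by omega) hj2
  have h4 := hF.varrho_lt h1 h2 (show j < j + 1 by omega) hjm
  rw [F.shift_eq_of_block hj1 hj2 h3 le_rfl,
    F.shift_eq_of_block (j := j + 1) (y := F.varrho v j + 1) (by omega) hjm
      (Nat.lt_succ_self _) h4]
  have := hF.vartheta_lt h1 h2 hj1 (show j < j + 1 by omega) hjm
  omega

theorem pos_succ_of_lt (hF : F.IsChain n) {v k : ℕ} (h1 : 1 ≤ v) (h2 : v ≤ F.z + 1)
    (hact : F.Active v (F.pos v (k + 1))) (hlt : F.pos v k < F.pos v (k + 1)) :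
    F.pos v (k + 1) = F.pos v k + 1 := by
  by_contra hne
  have h3 : F.Active v (F.pos v k + 1) := fun h => hlt.trans_le (hact h)
  have h4 := hF.suffixNat_lt h1 h2 (F.pos v k) (F.pos v k + 1) (by omega) h3
  have h5 := hF.suffixNat_lt h1 h2 (F.pos v k + 1) (F.pos v (k + 1)) (by omega) hact
  rw [suffixNat_pos] at h4 h5
  omega

theorem pos_lt_pos (hF : F.IsChain n) {v k l : ℕ} (h1 : 1 ≤ v) (h2 : v ≤ F.z + 1)
    (hact : F.Active v (F.pos v k)) (hkl : k < l) : F.pos v k < F.pos v l := by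
  refine hF.lt_of_suffixNat_lt h1 h2 hact ?_
  rwa [suffixNat_pos, suffixNat_pos]

theorem pos_le_rho_iff (hF : F.IsChain n) {v : ℕ} (h1 : 1 ≤ v) (h2 : v ≤ F.z) (k : ℕ) :
    F.pos v k ≤ F.rho v 1 ↔ F.pos 1 k ≤ F.rho v 1 := by
  rw [F.pos_eq_prefixNat v]
  refine apply_le_iff_of_fixed (fun p hp => hF.prefixNat_of_lt (by omega) ?_) _
  rwa [Nat.sub_add_cancel h1]

/-- The earlier factors do not move a value that lies beyond the blocks of the `v`-th factor. -/
theorem pos_eq_of_rho_lt (hF : F.IsChain n) {u v k : ℕ} (h1 : 1 ≤ u) (huv : u ≤ v)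
    (h2 : v ≤ F.z) (hk : F.rho v 1 < F.pos v k) : F.pos u k = F.pos v k ∧
      F.rho u 1 < F.pos u k := by
  have h3 : F.rho v 1 < F.pos 1 k := by
    have := hF.pos_le_rho_iff (h1.trans huv) h2 k
    omega
  have h4 := hF.rho_le h1 huv h2
  have h5 : ∀ w, 1 ≤ w → w ≤ v → F.pos w k = F.pos 1 k := fun w hw1 hw2 => by
    rw [F.pos_eq_prefixNat w]
    refine hF.prefixNat_of_lt (by omega) ?_
    rw [Nat.sub_add_cancel hw1]
    exact (hF.rho_le hw1 hw2 h2).trans_lt h3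
  rw [h5 u h1 huv, h5 v (h1.trans huv) le_rfl]
  exact ⟨rfl, by omega⟩

/-- If `k` ends a block of the `v`-th factor, then `k + 1` lies beyond its blocks. -/
theorem rho_lt_pos_succ_of_isEnd (hF : F.IsChain n) {v k : ℕ} (h1 : 1 ≤ v) (h2 : v ≤ F.z)
    (h : F.IsEnd v (F.pos v k)) : F.rho v 1 < F.pos v (k + 1) := by
  have hy := hF.le_rho_of_isEnd h1 h2 h
  by_contra hle
  have hle' := not_lt.1 hle
  have hlt := hF.pos_lt_pos h1 (by omega) (fun _ => hy.2) (Nat.lt_succ_self k)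
  have h3 := hF.pos_succ_of_lt h1 (by omega) (fun _ => hle') hlt
  have h4 := hF.active_succ h1 h2 hle'
  have h5 := hF.active_succ h1 h2 hy.2
  have h6 := hF.pos_succ_of_lt (by omega) (by omega) h4
    (hF.pos_lt_pos (by omega) (by omega) h5 (Nat.lt_succ_self k))
  have h7 := hF.factorNat_succ_of_isEnd h1 h2 (by omega) h
  rw [← h3, F.factorNat_pos h1, F.factorNat_pos h1] at h7
  omega

/-- If `k + 1` starts a block of the `v`-th factor, then `k` lies beyond its blocks. -/
theorem rho_lt_pos_of_isStart (hF : F.IsChain n) {v k : ℕ} (h1 : 1 ≤ v) (h2 : v ≤ F.z)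
    (hk : 1 ≤ k) (h : F.IsStart v (F.pos v (k + 1))) : F.rho v 1 < F.pos v k := by
  have hy := hF.le_rho_of_isStart h1 h2 h
  by_contra hle
  have hlt := hF.pos_lt_pos h1 (by omega) (fun _ => not_lt.1 hle) (Nat.lt_succ_self k)
  have h3 := hF.pos_succ_of_lt h1 (by omega) (fun _ => hy.2) hlt
  rw [h3] at h
  have h4 := F.isEnd_of_isStart_succ (hF.pos_pos (by omega) hk) h
  have := hF.rho_lt_pos_succ_of_isEnd h1 h2 h4
  omega

theorem pos_one_lt_of_isEnd (hF : F.IsChain n) {v k : ℕ} (h1 : 1 ≤ v) (h2 : v ≤ F.z)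
    (h : F.IsEnd v (F.pos v k)) : F.pos 1 k < F.pos 1 (k + 1) := by
  have h3 := hF.rho_lt_pos_succ_of_isEnd h1 h2 h
  have h4 := (hF.le_rho_of_isEnd h1 h2 h).2
  have h5 := hF.pos_le_rho_iff h1 h2 k
  have h6 := hF.pos_le_rho_iff h1 h2 (k + 1)
  omega

theorem pos_one_gt_of_isStart (hF : F.IsChain n) {v k : ℕ} (h1 : 1 ≤ v) (h2 : v ≤ F.z)
    (hk : 1 ≤ k) (h : F.IsStart v (F.pos v (k + 1))) : F.pos 1 (k + 1) < F.pos 1 k := by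
  have h3 := hF.rho_lt_pos_of_isStart h1 h2 hk h
  have h4 := (hF.le_rho_of_isStart h1 h2 h).2
  have h5 := hF.pos_le_rho_iff h1 h2 k
  have h6 := hF.pos_le_rho_iff h1 h2 (k + 1)
  omega

theorem not_isEnd_of_isStart (hF : F.IsChain n) {u v k : ℕ} (hu1 : 1 ≤ u) (hu2 : u ≤ F.z)
    (h1 : 1 ≤ v) (h2 : v ≤ F.z) (hk : 1 ≤ k) (h : F.IsStart v (F.pos v (k + 1))) :
    ¬ F.IsEnd u (F.pos u k) := fun h' => by
  have := hF.pos_one_gt_of_isStart h1 h2 hk h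
  have := hF.pos_one_lt_of_isEnd hu1 hu2 h'
  omega

/-- At a level where `k` does not end and `k + 1` does not start a block, the two values stay next
to each other, or stay beyond the blocks, and are translated by the same amount. -/
theorem neighbours_step (hF : F.IsChain n) {v k : ℕ} (h1 : 1 ≤ v) (h2 : v ≤ F.z) (hk : 1 ≤ k)
    (hend : ¬ F.IsEnd v (F.pos v k)) (hstart : ¬ F.IsStart v (F.pos v (k + 1)))
    (h : (F.pos (v + 1) (k + 1) = F.pos (v + 1) k + 1 ∧ F.Active (v + 1) (F.pos (v + 1) (k + 1))) ∨
      (v + 1 ≤ F.z ∧ F.rho (v + 1) 1 < F.pos (v + 1) k ∧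
        F.rho (v + 1) 1 < F.pos (v + 1) (k + 1))) :
    ((F.pos v (k + 1) = F.pos v k + 1 ∧ F.Active v (F.pos v (k + 1))) ∨
      (v ≤ F.z ∧ F.rho v 1 < F.pos v k ∧ F.rho v 1 < F.pos v (k + 1))) ∧
    F.shift v (F.pos v k) = F.shift v (F.pos v (k + 1)) := by
  rcases h with ⟨hadj, hact⟩ | ⟨hz, h3, h4⟩
  · by_cases hka : F.pos v k ≤ F.rho v 1
    · obtain ⟨h3, h4, h5⟩ := hF.factorNat_succ_of_not_isEnd h1 h2
        (hF.pos_pos (by omega) hk) hka hend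
      rw [F.factorNat_pos h1, ← hadj] at h5
      have h6 := F.pos_eq_of_factorNat_eq h1 h5
      rw [h6]
      exact ⟨Or.inl ⟨rfl, fun _ => h3⟩, h4.symm⟩
    · by_cases hka' : F.pos v (k + 1) ≤ F.rho v 1
      · exfalso
        obtain ⟨y, hy, -, -, h5⟩ := hF.exists_pred_of_not_isStart h1 h2
          (hF.pos_pos (by omega) (by omega)) hka' hstart
        rw [F.factorNat_pos h1, hadj] at h5
        have h6 := F.pos_eq_of_factorNat_eq (k := k) (y := y) h1 (by omega)
        omega
      · rw [F.shift_eq_zero_of_lt (by omega), F.shift_eq_zero_of_lt (by omega)]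
        exact ⟨Or.inr ⟨h2, by omega, by omega⟩, rfl⟩
  · have h5 := (hF.pos_eq_of_rho_lt h1 (Nat.le_succ v) hz h3).2
    have h6 := (hF.pos_eq_of_rho_lt h1 (Nat.le_succ v) hz h4).2
    rw [F.shift_eq_zero_of_lt h5, F.shift_eq_zero_of_lt h6]
    exact ⟨Or.inr ⟨h2, h5, h6⟩, rfl⟩

theorem neighbours (hF : F.IsChain n) {v k : ℕ} (h1 : 1 ≤ v) (h2 : v ≤ F.z + 1) (hk : 1 ≤ k) :
    (∀ u, v ≤ u → u ≤ F.z → ¬ F.IsEnd u (F.pos u k) ∧ ¬ F.IsStart u (F.pos u (k + 1))) →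
    ((F.pos v (k + 1) = F.pos v k + 1 ∧ F.Active v (F.pos v (k + 1))) ∨
      (v ≤ F.z ∧ F.rho v 1 < F.pos v k ∧ F.rho v 1 < F.pos v (k + 1))) ∧
    ∑ u ∈ Finset.Ico v (F.z + 1), F.shift u (F.pos u k) =
      ∑ u ∈ Finset.Ico v (F.z + 1), F.shift u (F.pos u (k + 1)) := by
  refine downward_induction (z := F.z) (P := fun v =>
    (∀ u, v ≤ u → u ≤ F.z → ¬ F.IsEnd u (F.pos u k) ∧ ¬ F.IsStart u (F.pos u (k + 1))) →
    ((F.pos v (k + 1) = F.pos v k + 1 ∧ F.Active v (F.pos v (k + 1))) ∨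
      (v ≤ F.z ∧ F.rho v 1 < F.pos v k ∧ F.rho v 1 < F.pos v (k + 1))) ∧
    ∑ u ∈ Finset.Ico v (F.z + 1), F.shift u (F.pos u k) =
      ∑ u ∈ Finset.Ico v (F.z + 1), F.shift u (F.pos u (k + 1))) ?_ ?_ h1 h2
  · intro _
    refine ⟨Or.inl ⟨?_, F.active_top _⟩, by simp⟩
    rw [pos_top, pos_top]
  · intro v h1 h2 ih hu
    obtain ⟨h3, h4⟩ := ih fun u hu1 hu2 => hu u (by omega) hu2
    obtain ⟨h5, h6⟩ := hF.neighbours_step h1 h2 hk (hu v le_rfl h2).1 (hu v le_rfl h2).2 h3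
    refine ⟨h5, ?_⟩
    rw [Finset.sum_eq_sum_Ico_succ_bot (show v < F.z + 1 by omega),
      Finset.sum_eq_sum_Ico_succ_bot (show v < F.z + 1 by omega), h4, h6]

/-! ### The Lehmer code as a sum of shifts -/

theorem rankLE_of_active (hF : F.IsChain n) {v k : ℕ} (h1 : 1 ≤ v) (h2 : v ≤ F.z + 1)
    (hact : F.Active v (F.pos v k)) : rankLE (F.suffixNat v)⁻¹ k (F.pos v k) = F.pos v k := by
  have h : ((Finset.Icc 1 k).filter fun x => (F.suffixNat v)⁻¹ x ≤ F.pos v k).image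
      (F.pos v) = Finset.Icc 1 (F.pos v k) := by
    ext q
    simp only [Finset.mem_image, Finset.mem_filter, Finset.mem_Icc]
    constructor
    · rintro ⟨x, ⟨⟨hx1, hx2⟩, hx3⟩, rfl⟩
      exact ⟨hF.pos_pos h2 hx1, hx3⟩
    · rintro ⟨hq1, hq2⟩
      refine ⟨F.suffixNat v q, ⟨⟨?_, ?_⟩, ?_⟩, perm_inv_apply _ q⟩
      · have h3 := hF.suffixNat_lt h1 h2 0 q (by omega) fun h => hq2.trans (hact h)
        omega
      · have h3 := hF.suffixNat_le h1 h2 hq2 hact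
        rwa [suffixNat_pos] at h3
      · rwa [perm_inv_apply]
  have := congrArg Finset.card h
  rw [Finset.card_image_of_injective _ (F.pos_injective v), Nat.card_Icc,
    Nat.add_sub_cancel] at this
  exact this

/-- A factor that does not translate `k` does not change the order of `k` relative to the smaller
values. -/
theorem pos_le_pos_iff (hF : F.IsChain n) {v i k : ℕ} (h1 : 1 ≤ v) (h2 : v ≤ F.z) (hik : i ≤ k)
    (hk : F.rho v 1 < F.pos v k) :
    F.pos v i ≤ F.pos v k ↔ F.pos (v + 1) i ≤ F.pos (v + 1) k := by
  have hmono : F.rho v 1 < F.pos v i →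
      (F.pos v i ≤ F.pos v k ↔ F.pos (v + 1) i ≤ F.pos (v + 1) k) := fun h => by
    rw [← F.factorNat_pos h1, ← F.factorNat_pos h1,
      (hF.strictMonoOn_Ioi h1 h2).le_iff_le h hk]
  by_cases hi : F.rho v 1 < F.pos v i
  · exact hmono hi
  · have hact := hF.active_succ h1 h2 (not_lt.1 hi)
    refine iff_of_true (by omega) ?_
    rcases hik.eq_or_lt with rfl | hlt
    · exact le_rfl
    · exact (hF.pos_lt_pos (by omega) (by omega) hact hlt).le

theorem rankLE_add_sum_shift (hF : F.IsChain n) {v k : ℕ} (h1 : 1 ≤ v) (h2 : v ≤ F.z + 1)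
    (hk : 1 ≤ k) :
    rankLE (F.suffixNat v)⁻¹ k (F.pos v k) +
      ∑ u ∈ Finset.Ico v (F.z + 1), F.shift u (F.pos u k) = k := by
  refine downward_induction (z := F.z) (P := fun v => rankLE (F.suffixNat v)⁻¹ k (F.pos v k) +
      ∑ u ∈ Finset.Ico v (F.z + 1), F.shift u (F.pos u k) = k) ?_ ?_ h1 h2
  · rw [hF.rankLE_of_active (by omega) le_rfl (F.active_top _), pos_top]
    simp
  · intro v h1 h2 ih
    rw [Finset.sum_eq_sum_Ico_succ_bot (show v < F.z + 1 by omega)]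
    by_cases hact : F.pos v k ≤ F.rho v 1
    · rw [hF.rankLE_of_active (by omega) (by omega) (hF.active_succ h1 h2 hact),
        ← F.factorNat_pos h1, hF.factorNat_eq h1 h2 (hF.pos_pos (by omega) hk) hact] at ih
      rw [hF.rankLE_of_active h1 (by omega) fun _ => hact]
      omega
    · have h3 : rankLE (F.suffixNat v)⁻¹ k (F.pos v k) =
          rankLE (F.suffixNat (v + 1))⁻¹ k (F.pos (v + 1) k) := by
        rw [rankLE, rankLE]
        refine congrArg Finset.card (Finset.filter_congr fun i hi => ?_)
        rw [Finset.mem_Icc] at hi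
        exact hF.pos_le_pos_iff h1 h2 hi.2 (by omega)
      rw [h3, F.shift_eq_zero_of_lt (by omega), zero_add]
      exact ih

theorem lehmer_eq_sum_shift (hF : F.IsChain n) {k : ℕ} (hk : 1 ≤ k) :
    lehmer (F.suffixNat 1)⁻¹ k = ∑ u ∈ Finset.Ico 1 (F.z + 1), F.shift u (F.pos u k) := by
  have := hF.rankLE_add_sum_shift le_rfl (by omega) hk
  rw [lehmer]
  rw [pos] at this
  omega

end IsChain

/-! ### The numbers `χ` and `η` -/

open scoped Classical in
theorem chi_lt (F : Factors) {v : ℕ} (hv : 1 ≤ v) (j : ℕ) : F.chi v j < v := by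
  rw [chi, Finset.sup_lt_iff (by rwa [bot_eq_zero])]
  intro u hu
  rw [Finset.mem_filter, Finset.mem_Ico] at hu
  exact hu.1.2

open scoped Classical in
theorem chiCond_chi {F : Factors} {v j : ℕ} (h : 1 ≤ F.chi v j) : F.ChiCond v j (F.chi v j) := by
  have hne : ((Finset.Ico 1 v).filter fun v' => F.ChiCond v j v').Nonempty := by
    by_contra hempty
    rw [Finset.not_nonempty_iff_eq_empty] at hempty
    rw [chi] at h
    simp [hempty] at h
  obtain ⟨u, hu, heq⟩ := Finset.exists_mem_eq_sup _ hne id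
  rw [chi, heq]
  exact (Finset.mem_filter.1 hu).2

open scoped Classical in
theorem not_chiCond_of_chi_lt {F : Factors} {v j u : ℕ} (h : F.chi v j < u) (huv : u < v) :
    ¬ F.ChiCond v j u := fun hu => by
  have : u ≤ F.chi v j :=
    Finset.le_sup (f := id) (Finset.mem_filter.2 ⟨Finset.mem_Ico.2 ⟨by omega, huv⟩, hu⟩)
  omega

namespace IsChain

variable {F : Factors} {n : ℕ}

theorem kappaPlus_le_iff (hF : F.IsChain n) {u j x : ℕ} (h1 : 1 ≤ u) (h2 : u ≤ F.z)
    (hj1 : 1 ≤ j) (hj2 : j ≤ F.m u) (hx : F.pos u x ≤ F.rho u 1) :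
    F.kappaPlus u j ≤ x ↔ F.varrho u j ≤ F.pos u x := by
  have := hF.pos_lt_iff h1 (by omega) (k := x) (y := F.varrho u j) (fun _ => hx)
    (fun _ => F.varrho_le_rho hj2)
  rw [← hF.kappaPlus_eq h1 h2 hj1 hj2] at this
  omega

theorem kappaMinus_lt_iff (hF : F.IsChain n) {u j x : ℕ} (h1 : 1 ≤ u) (h2 : u ≤ F.z)
    (hj1 : 1 ≤ j) (hj2 : j ≤ F.m u) (hx : F.pos u x ≤ F.rho u 1) :
    F.kappaMinus u j < x ↔ F.varrho u (j - 1) < F.pos u x := by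
  have h3 := hF.varrho_lt h1 h2 (show j - 1 < j by omega) hj2
  have h4 := F.varrho_le_rho hj2
  have := hF.pos_lt_iff h1 (by omega) (k := x) (y := F.varrho u (j - 1) + 1) (fun _ => hx)
    (fun _ => by omega)
  rw [← hF.kappaMinus_add_one h1 h2 hj1 hj2] at this
  omega

theorem not_chiCond (hF : F.IsChain n) {v j u : ℕ} (h1 : 1 ≤ u) (h2 : u ≤ F.z)
    (hpos : 1 ≤ F.kappaPlus v j) (hx : F.pos u (F.kappaPlus v j) ≤ F.rho u 1)
    (hend : ¬ F.IsEnd u (F.pos u (F.kappaPlus v j))) : ¬ F.ChiCond v j u := by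
  have hy := hF.pos_pos (v := u) (by omega) hpos
  have hm := (hF.word h1 h2).1
  rintro (⟨j', ⟨hj1, hj2⟩, h3, h4⟩ | h3 | h3)
  · rw [hF.kappaPlus_le_iff h1 h2 hj1 hj2.le hx] at h3
    have h5 := hF.kappaMinus_lt_iff h1 h2 (j := j' + 1) (by omega) hj2 hx
    rw [Nat.add_sub_cancel] at h5
    exact hend ⟨j', hj1, hj2.le, by omega⟩
  · have h5 := hF.kappaMinus_lt_iff h1 h2 le_rfl hm hx
    simp [varrho] at h5
    omega
  · rw [hF.kappaPlus_le_iff h1 h2 hm le_rfl hx] at h3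
    exact hend ⟨F.m u, hm, le_rfl, le_antisymm hx h3⟩

/-- If the condition defining `χ` fails at the level `u` for a value `x` that the later factors have
not moved beyond their blocks, then `x` lies in a block of the `u`-th factor and does not end it. -/
theorem of_not_chiCond (hF : F.IsChain n) {v j u : ℕ} (hv1 : 1 ≤ v) (hv2 : v ≤ F.z)
    (hj1 : 1 ≤ j) (hj2 : j ≤ F.m v) (h1 : 1 ≤ u) (h2 : u ≤ F.z)
    (hpos : 1 ≤ F.kappaPlus v j)
    (hact : F.Active (u + 1) (F.pos (u + 1) (F.kappaPlus v j))) (h : ¬ F.ChiCond v j u) :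
    F.pos u (F.kappaPlus v j) ≤ F.rho u 1 ∧ ¬ F.IsEnd u (F.pos u (F.kappaPlus v j)) := by
  set x := F.kappaPlus v j with hx
  have hm := (hF.word h1 h2).1
  have hxend : F.IsEnd v (F.pos v x) :=
    ⟨j, hj1, hj2, (hF.kappaPlus_eq_iff hv1 hv2 hj1 hj2).1 hx.symm⟩
  rw [ChiCond, ← hx] at h
  push Not at h
  obtain ⟨ha, hb, hc⟩ := h
  -- otherwise `x` would lie beyond one block after another, hence beyond the last one
  obtain ⟨i, hi1, hi2, hi3, hi4⟩ : ∃ i, 1 ≤ i ∧ i ≤ F.m u ∧ F.kappaMinus u i ≤ x ∧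
      x < F.kappaPlus u i := by
    by_contra hno
    push Not at hno
    have : ∀ i, 1 ≤ i → i ≤ F.m u → F.kappaMinus u i ≤ x := by
      intro i hi1
      induction i, hi1 using Nat.le_induction with
      | base => exact fun _ => hb
      | succ i hi1 ih => exact fun hi2 => ha i ⟨hi1, hi2⟩ (hno i hi1 (by omega) (ih (by omega)))
    have := hno (F.m u) hm le_rfl (this _ hm le_rfl)
    omega
  have hlt := hF.varrho_lt h1 h2 (show i - 1 < i by omega) hi2
  have hle := F.varrho_le_rho hi2
  have hi3' : F.kappaMinus u i < x := by
    refine lt_of_le_of_ne hi3 fun heq => ?_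
    exact hF.not_isEnd_of_isStart hv1 hv2 h1 h2 hpos
      ⟨i, hi1, hi2, (hF.kappaMinus_eq_iff h1 h2 hi1 hi2).1 heq⟩ hxend
  have h3 : F.varrho u (i - 1) + 1 + F.vartheta u i ≤ F.pos (u + 1) x := by
    have h4 := hF.kappaMinus_add_one h1 h2 hi1 hi2
    rw [← F.suffixNat_succ h1, hF.factorNat_eq h1 h2 (by omega) (by omega),
      F.shift_eq_of_block hi1 hi2 (Nat.lt_succ_self _) hlt] at h4
    have hact' : F.Active (u + 1) (F.varrho u (i - 1) + 1 + F.vartheta u i) := by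
      have := hF.active_factorNat h1 h2 (y := F.varrho u (i - 1) + 1) (by omega)
      rwa [hF.factorNat_eq h1 h2 (by omega) (by omega),
        F.shift_eq_of_block hi1 hi2 (Nat.lt_succ_self _) hlt] at this
    have h5 := hF.pos_lt_iff (by omega) (by omega) hact hact'
    omega
  have h4 : F.pos (u + 1) x < F.varrho u i + F.vartheta u i := by
    have h4 := hF.kappaPlus_eq h1 h2 hi1 hi2
    rw [← F.suffixNat_succ h1, hF.factorNat_eq h1 h2 (by omega) (by omega),
      F.shift_eq_of_block hi1 hi2 hlt le_rfl] at h4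
    refine hF.lt_of_suffixNat_lt (v := u + 1) (by omega) (by omega) ?_ ?_
    · have := hF.active_factorNat h1 h2 (y := F.varrho u i) hle
      rwa [hF.factorNat_eq h1 h2 (by omega) (by omega),
        F.shift_eq_of_block hi1 hi2 hlt le_rfl] at this
    · rwa [suffixNat_pos, ← h4]
  have h5 : F.pos u x = F.pos (u + 1) x - F.vartheta u i := by
    refine F.pos_eq_of_factorNat_eq h1 ?_
    rw [hF.factorNat_eq h1 h2 (by omega) (by omega),
      F.shift_eq_of_block hi1 hi2 (by omega) (by omega)]
    omega
  refine ⟨by omega, ?_⟩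
  rintro ⟨i', hi1', hi2', h6⟩
  obtain rfl : i = i' := by
    have h7 := hF.varrho_lt h1 h2 (show i' - 1 < i' by omega) hi2'
    simp only [varrho] at *
    exact block_unique (f := F.i u) (p := F.pos u x) hi1 hi1' (by omega) (by omega) (by omega)
      (by omega)
  omega

/-- Between the levels `χ` and `v`, the value `κ_{+;j}` of level `v` stays inside blocks. -/
theorem pos_of_chi_lt (hF : F.IsChain n) {v j : ℕ} (hv1 : 1 ≤ v) (hv2 : v ≤ F.z) (hj1 : 1 ≤ j)
    (hj2 : j ≤ F.m v) {u : ℕ} (hu1 : F.chi v j < u) (hu2 : u ≤ v) :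
    F.pos u (F.kappaPlus v j) ≤ F.rho u 1 ∧
      (u < v → ¬ F.IsEnd u (F.pos u (F.kappaPlus v j))) := by
  have hx := (hF.kappaPlus_eq_iff hv1 hv2 hj1 hj2).1 rfl
  have hle := F.varrho_le_rho hj2
  have hpos : 1 ≤ F.kappaPlus v j := (hF.suffixNat_kappaPlusStep hv1 hj1 hj2 _ (by omega)).2.1
  obtain ⟨d, hd⟩ : ∃ d, u + d = v := ⟨v - u, by omega⟩
  induction d generalizing u with
  | zero =>
    obtain rfl : u = v := by omega
    exact ⟨by omega, fun h => by omega⟩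
  | succ d ih =>
    obtain ⟨h3, -⟩ := ih (u := u + 1) (by omega) (by omega) (by omega)
    have h4 := hF.of_not_chiCond hv1 hv2 hj1 hj2 (u := u) (by omega) (by omega) hpos (fun _ => h3)
      (not_chiCond_of_chi_lt hu1 (by omega))
    exact ⟨h4.1, fun _ => h4.2⟩

/-- At the level `χ ≥ 1` the value `κ_{+;j}` of level `v` ends a block or lies beyond the blocks. -/
theorem pos_chi (hF : F.IsChain n) {v j : ℕ} (hv1 : 1 ≤ v) (hv2 : v ≤ F.z) (hj1 : 1 ≤ j)
    (hj2 : j ≤ F.m v) (h : 1 ≤ F.chi v j) :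
    F.rho (F.chi v j) 1 < F.pos (F.chi v j) (F.kappaPlus v j) ∨
      F.IsEnd (F.chi v j) (F.pos (F.chi v j) (F.kappaPlus v j)) := by
  have hpos : 1 ≤ F.kappaPlus v j := (hF.suffixNat_kappaPlusStep hv1 hj1 hj2 _ (by omega)).2.1
  have hlt := F.chi_lt hv1 j
  by_contra hno
  push Not at hno
  exact hF.not_chiCond h (by omega) hpos hno.1 hno.2 (chiCond_chi h)

theorem eta_eq_sum_shift (hF : F.IsChain n) {v j : ℕ} (hv1 : 1 ≤ v) (hv2 : v ≤ F.z) (hj1 : 1 ≤ j)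
    (hj2 : j ≤ F.m v) :
    F.eta v j = ∑ u ∈ Finset.Ico (F.chi v j + 1) v, F.shift u (F.pos u (F.kappaPlus v j)) := by
  rw [eta, if_neg (by omega)]
  refine Finset.sum_congr rfl fun u hu => ?_
  rw [Finset.mem_Ico] at hu
  obtain ⟨h3, h4⟩ := hF.pos_of_chi_lt hv1 hv2 hj1 hj2 (u := u) (by omega) (by omega)
  rw [shift]
  refine Finset.sum_congr (Finset.filter_congr fun i hi => ?_) fun _ _ => rfl
  rw [Finset.mem_Icc] at hi
  have h5 := hF.kappaMinus_lt_iff (x := F.kappaPlus v j) (by omega) (by omega) hi.1 hi.2 h3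
  have h6 := hF.kappaPlus_le_iff (x := F.kappaPlus v j) (by omega) (by omega) hi.1 hi.2 h3
  have h7 : F.pos u (F.kappaPlus v j) ≠ F.varrho u i := fun h =>
    h4 hu.2 ⟨i, hi.1, hi.2, h⟩
  omega

end IsChain
end Factors

/-! ### The sums over all pairs with a given `κ` -/

/-- If every `f v` with `v` in `P` collects the terms of `s` between the level before `v` that is
in `P` (or below which `s` vanishes) and `v`, then the sums of `f` and `s` up to `v` agree. -/
theorem sum_eq_sum_of_telescoping {f s : ℕ → ℕ} {P : ℕ → Prop} {z : ℕ}
    (hf : ∀ v, 1 ≤ v → v ≤ z → ¬ P v → f v = 0)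
    (hP : ∀ v, 1 ≤ v → v ≤ z → P v → ∃ c < v, f v = ∑ u ∈ Finset.Ico (c + 1) (v + 1), s u ∧
      (∀ u, c < u → u < v → ¬ P u) ∧
      (c = 0 ∨ P c ∨ ∀ u, 1 ≤ u → u ≤ c → s u = 0 ∧ ¬ P u))
    {v : ℕ} (h1 : 1 ≤ v) (h2 : v ≤ z) (hv : P v) :
    ∑ u ∈ Finset.Ico 1 (v + 1), f u = ∑ u ∈ Finset.Ico 1 (v + 1), s u := by
  induction v using Nat.strong_induction_on with
  | _ v ih =>
  obtain ⟨c, hcv, hfv, hno, hc⟩ := hP v h1 h2 hv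
  have hlast : ∑ u ∈ Finset.Ico (c + 1) (v + 1), f u = f v := by
    refine Finset.sum_eq_single_of_mem v (Finset.mem_Ico.2 ⟨hcv, Nat.lt_succ_self v⟩) ?_
    intro u hu hne
    rw [Finset.mem_Ico] at hu
    exact hf u (by omega) (by omega) (hno u (by omega) (by omega))
  have hfirst : ∑ u ∈ Finset.Ico 1 (c + 1), f u = ∑ u ∈ Finset.Ico 1 (c + 1), s u := by
    rcases hc with rfl | hc | hc
    · rfl
    · by_cases hc0 : c = 0
      · rw [hc0]
        rfl
      · exact ih c hcv (by omega) (by omega) hc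
    · refine Finset.sum_congr rfl fun u hu => ?_
      rw [Finset.mem_Ico] at hu
      have h3 := hc u hu.1 (by omega)
      rw [h3.1, hf u hu.1 (by omega) h3.2]
  rw [← Finset.sum_Ico_consecutive f (show 1 ≤ c + 1 by omega) (show c + 1 ≤ v + 1 by omega),
    ← Finset.sum_Ico_consecutive s (show 1 ≤ c + 1 by omega) (show c + 1 ≤ v + 1 by omega),
    hlast, hfv, hfirst]

namespace Factors

theorem sum_indices_filter (F : Factors) (p : ℕ → ℕ → Prop) [∀ v j, Decidable (p v j)]
    (t : ℕ → ℕ → ℕ) :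
    ∑ q ∈ F.indices.filter (fun q => p q.1 q.2), t q.1 q.2 =
      ∑ v ∈ Finset.Ico 1 (F.z + 1), ∑ j ∈ Finset.Icc 1 (F.m v), if p v j then t v j else 0 := by
  rw [Finset.sum_filter, indices, Finset.sum_sigma]
  rfl

namespace IsChain

variable {F : Factors} {n : ℕ}

/-- Let `v` be the last level at which `k` ends a block. The sum over all pairs with `κ_+ = k` is
the total shift of `k` at the levels up to `v`. -/
theorem sum_kappaPlus (hF : F.IsChain n) {v k : ℕ} (h1 : 1 ≤ v) (h2 : v ≤ F.z)
    (hv : F.IsEnd v (F.pos v k)) (hmax : ∀ u, v < u → u ≤ F.z → ¬ F.IsEnd u (F.pos u k)) :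
    ∑ q ∈ F.indices.filter (fun q => F.kappaPlus q.1 q.2 = k),
      (F.vartheta q.1 q.2 + F.eta q.1 q.2) =
      ∑ u ∈ Finset.Ico 1 (v + 1), F.shift u (F.pos u k) := by
  rw [F.sum_indices_filter (fun v j => F.kappaPlus v j = k)
    (fun v j => F.vartheta v j + F.eta v j)]
  have hf : ∀ v, 1 ≤ v → v ≤ F.z → ¬ F.IsEnd v (F.pos v k) →
      (∑ j ∈ Finset.Icc 1 (F.m v),
        if F.kappaPlus v j = k then F.vartheta v j + F.eta v j else 0) = 0 := by
    intro v h1 h2 hv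
    refine Finset.sum_eq_zero fun j hj => if_neg fun h => ?_
    rw [Finset.mem_Icc] at hj
    exact hv ⟨j, hj.1, hj.2, (hF.kappaPlus_eq_iff h1 h2 hj.1 hj.2).1 h⟩
  rw [← Finset.sum_Ico_consecutive _ (show 1 ≤ v + 1 by omega) (show v + 1 ≤ F.z + 1 by omega),
    Finset.sum_eq_zero (s := Finset.Ico (v + 1) (F.z + 1)) fun u hu => by
      rw [Finset.mem_Ico] at hu
      exact hf u (by omega) (by omega) (hmax u (by omega) (by omega)), add_zero]
  refine sum_eq_sum_of_telescoping (P := fun v => F.IsEnd v (F.pos v k)) hf ?_ h1 h2 hv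
  rintro v h1 h2 ⟨j, hj1, hj2, hj⟩
  have hk : F.kappaPlus v j = k := (hF.kappaPlus_eq_iff h1 h2 hj1 hj2).2 hj
  have hchi := F.chi_lt h1 j
  have hlt := hF.varrho_lt h1 h2 (show j - 1 < j by omega) hj2
  refine ⟨F.chi v j, hchi, ?_, ?_, ?_⟩
  · rw [Finset.sum_eq_single_of_mem j (Finset.mem_Icc.2 ⟨hj1, hj2⟩), if_pos hk,
      hF.eta_eq_sum_shift h1 h2 hj1 hj2, hk, Finset.sum_Ico_succ_top (by omega),
      hj, F.shift_eq_of_block hj1 hj2 hlt le_rfl, add_comm]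
    intro j' hj' hne
    rw [Finset.mem_Icc] at hj'
    refine if_neg fun h => hne ?_
    rw [hF.kappaPlus_eq_iff h1 h2 hj'.1 hj'.2, hj] at h
    exact (hF.varrho_inj h1 h2 hj2 hj'.2 h).symm
  · intro u hu1 hu2
    have := (hF.pos_of_chi_lt h1 h2 hj1 hj2 hu1 hu2.le).2 hu2
    rwa [hk] at this
  · by_cases hc : F.chi v j = 0
    · exact Or.inl hc
    · have h3 := hF.pos_chi h1 h2 hj1 hj2 (by omega)
      rw [hk] at h3
      rcases h3 with h3 | h3
      · refine Or.inr (Or.inr fun u hu1 hu2 => ?_)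
        have h4 := (hF.pos_eq_of_rho_lt hu1 hu2 (by omega) h3).2
        refine ⟨F.shift_eq_zero_of_lt h4, fun h5 => ?_⟩
        have := (hF.le_rho_of_isEnd hu1 (by omega) h5).2
        omega
      · exact Or.inr (Or.inl h3)

/-- Let `k` be the first value of the block that follows the `j`-th one at level `v`. Down to the
level above `χ`, the values `κ_{+;j}` and `k` occupy neighbouring positions, which below `v` lie
in a common block. -/
theorem pos_succ_of_chi_lt (hF : F.IsChain n) {v j k : ℕ} (hv1 : 1 ≤ v) (hv2 : v ≤ F.z)
    (hj1 : 1 ≤ j) (hj2 : j ≤ F.m v) (hk : F.pos v k = F.varrho v j + 1)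
    {u : ℕ} (hu1 : F.chi v j < u) (hu2 : u ≤ v) :
    F.pos u k = F.pos u (F.kappaPlus v j) + 1 ∧
      (u < v → F.shift u (F.pos u k) = F.shift u (F.pos u (F.kappaPlus v j)) ∧
        ¬ F.IsStart u (F.pos u k)) := by
  have hx := (hF.kappaPlus_eq_iff hv1 hv2 hj1 hj2).1 rfl
  have hpos : 1 ≤ F.kappaPlus v j := (hF.suffixNat_kappaPlusStep hv1 hj1 hj2 _ (by omega)).2.1
  obtain ⟨d, hd⟩ : ∃ d, u + d = v := ⟨v - u, by omega⟩
  induction d generalizing u with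
  | zero =>
    obtain rfl : u = v := by omega
    exact ⟨by omega, fun h => by omega⟩
  | succ d ih =>
    obtain ⟨h3, -⟩ := ih (u := u + 1) (by omega) (by omega) (by omega)
    obtain ⟨h4, h5⟩ := hF.pos_of_chi_lt hv1 hv2 hj1 hj2 hu1 hu2
    have h6 := hF.pos_pos (v := u) (by omega) hpos
    obtain ⟨h7, h8, h9⟩ := hF.factorNat_succ_of_not_isEnd (by omega) (by omega) h6 h4
      (h5 (by omega))
    rw [F.factorNat_pos (by omega), ← h3] at h9
    have h10 := F.pos_eq_of_factorNat_eq (by omega) h9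
    rw [h10]
    exact ⟨rfl, fun _ => ⟨h8, fun h => h5 (by omega) (F.isEnd_of_isStart_succ h6 h)⟩⟩

/-- At the level `χ ≥ 1`, the first value `k` of the block that follows the `j`-th one at level
`v` starts a block or lies beyond the blocks. -/
theorem pos_chi_succ (hF : F.IsChain n) {v j k : ℕ} (hv1 : 1 ≤ v) (hv2 : v ≤ F.z)
    (hj1 : 1 ≤ j) (hj2 : j ≤ F.m v) (hk : F.pos v k = F.varrho v j + 1) (h : 1 ≤ F.chi v j) :
    F.rho (F.chi v j) 1 < F.pos (F.chi v j) k ∨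
      F.IsStart (F.chi v j) (F.pos (F.chi v j) k) := by
  have hpos : 1 ≤ F.kappaPlus v j := (hF.suffixNat_kappaPlusStep hv1 hj1 hj2 _ (by omega)).2.1
  have hlt := F.chi_lt hv1 j
  by_contra hno
  obtain ⟨hle, hstart⟩ := not_or.1 hno
  rw [not_lt] at hle
  have hadj := (hF.pos_succ_of_chi_lt hv1 hv2 hj1 hj2 hk (u := F.chi v j + 1) (by omega)
    (by omega)).1
  have hchi := hF.pos_chi hv1 hv2 hj1 hj2 h
  generalize F.chi v j = c at *
  have hk0 : 1 ≤ F.pos c k := by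
    by_contra h0
    have h3 := F.factorNat_pos h k
    rw [show F.pos c k = 0 by omega, hF.factorNat_zero h (by omega), hadj] at h3
    omega
  obtain ⟨y, hy, -, hne, h5⟩ := hF.exists_pred_of_not_isStart h (by omega) hk0 hle hstart
  rw [F.factorNat_pos h, hadj] at h5
  have h6 := F.pos_eq_of_factorNat_eq (k := F.kappaPlus v j) (y := y) h (by omega)
  rw [h6] at hchi
  rcases hchi with h7 | h7
  · omega
  · exact hne h7

/-- Let `v` be the last level at which `k + 1` starts a block. The sum over all pairs with `κ_- =
k` is the total shift of `k + 1` at the levels up to `v`. -/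
theorem sum_kappaMinus (hF : F.IsChain n) {v k : ℕ} (h1 : 1 ≤ v) (h2 : v ≤ F.z)
    (hv : F.IsStart v (F.pos v (k + 1)))
    (hmax : ∀ u, v < u → u ≤ F.z → ¬ F.IsStart u (F.pos u (k + 1))) :
    ∑ q ∈ F.indices.filter (fun q => F.kappaMinus q.1 q.2 = k),
      (F.vartheta q.1 q.2 + F.eta q.1 (q.2 - 1)) =
      ∑ u ∈ Finset.Ico 1 (v + 1), F.shift u (F.pos u (k + 1)) := by
  rw [F.sum_indices_filter (fun v j => F.kappaMinus v j = k)
    (fun v j => F.vartheta v j + F.eta v (j - 1))]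
  have hf : ∀ v, 1 ≤ v → v ≤ F.z → ¬ F.IsStart v (F.pos v (k + 1)) →
      (∑ j ∈ Finset.Icc 1 (F.m v),
        if F.kappaMinus v j = k then F.vartheta v j + F.eta v (j - 1) else 0) = 0 := by
    intro v h1 h2 hv
    refine Finset.sum_eq_zero fun j hj => if_neg fun h => ?_
    rw [Finset.mem_Icc] at hj
    exact hv ⟨j, hj.1, hj.2, (hF.kappaMinus_eq_iff h1 h2 hj.1 hj.2).1 h⟩
  rw [← Finset.sum_Ico_consecutive _ (show 1 ≤ v + 1 by omega) (show v + 1 ≤ F.z + 1 by omega),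
    Finset.sum_eq_zero (s := Finset.Ico (v + 1) (F.z + 1)) fun u hu => by
      rw [Finset.mem_Ico] at hu
      exact hf u (by omega) (by omega) (hmax u (by omega) (by omega)), add_zero]
  refine sum_eq_sum_of_telescoping (P := fun v => F.IsStart v (F.pos v (k + 1))) hf ?_ h1 h2 hv
  rintro v h1 h2 ⟨j, hj1, hj2, hj⟩
  have hk : F.kappaMinus v j = k := (hF.kappaMinus_eq_iff h1 h2 hj1 hj2).2 hj
  have hlt := hF.varrho_lt h1 h2 (show j - 1 < j by omega) hj2
  have hsum : (∑ i ∈ Finset.Icc 1 (F.m v),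
      if F.kappaMinus v i = k then F.vartheta v i + F.eta v (i - 1) else 0) =
      F.eta v (j - 1) + F.shift v (F.pos v (k + 1)) := by
    rw [Finset.sum_eq_single_of_mem j (Finset.mem_Icc.2 ⟨hj1, hj2⟩), if_pos hk, hj,
      F.shift_eq_of_block hj1 hj2 (Nat.lt_succ_self _) hlt, add_comm]
    intro j' hj' hne
    rw [Finset.mem_Icc] at hj'
    refine if_neg fun h => hne ?_
    rw [hF.kappaMinus_eq_iff h1 h2 hj'.1 hj'.2, hj] at h
    have := hF.varrho_inj h1 h2 (j := j - 1) (j' := j' - 1) (by omega) (by omega) (by omega)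
    omega
  -- once `k + 1` lies beyond the blocks, it stays there
  have hbeyond : ∀ c, c ≤ F.z → F.rho c 1 < F.pos c (k + 1) → ∀ u, 1 ≤ u → u ≤ c →
      F.shift u (F.pos u (k + 1)) = 0 ∧ ¬ F.IsStart u (F.pos u (k + 1)) := by
    intro c hc h3 u hu1 hu2
    have h4 := (hF.pos_eq_of_rho_lt hu1 hu2 hc h3).2
    refine ⟨F.shift_eq_zero_of_lt h4, fun h5 => ?_⟩
    have := (hF.le_rho_of_isStart hu1 (by omega) h5).2
    omega
  by_cases hj0 : j = 1
  · -- the value in the first position can only come from the first position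
    subst hj0
    have hj' : F.pos v (k + 1) = 1 := by simpa [varrho] using hj
    refine ⟨v - 1, by omega, ?_, fun u _ _ => by omega, ?_⟩
    · rw [hsum, eta, if_pos rfl, zero_add, Nat.sub_add_cancel h1, Finset.sum_Ico_succ_top le_rfl,
        Finset.Ico_self, Finset.sum_empty, zero_add]
    · by_cases hv0 : v - 1 = 0
      · exact Or.inl hv0
      right
      by_cases hle : F.pos (v - 1) (k + 1) ≤ F.rho (v - 1) 1
      · left
        have h3 := F.factorNat_pos (v := v - 1) (by omega) (k + 1)
        have h4 := hF.pos_pos (v := v - 1) (k := k + 1) (by omega) (by omega)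
        rw [Nat.sub_add_cancel h1, hj', hF.factorNat_eq (by omega) (by omega) h4 hle] at h3
        exact ⟨1, le_rfl, (hF.word (v := v - 1) (by omega) (by omega)).1, by
          simp [varrho]; omega⟩
      · exact Or.inr (hbeyond (v - 1) (by omega) (by omega))
  · have hj1' : 1 ≤ j - 1 := by omega
    have hj2' : j - 1 ≤ F.m v := by omega
    have hchi := F.chi_lt h1 (j - 1)
    refine ⟨F.chi v (j - 1), hchi, ?_, ?_, ?_⟩
    · rw [hsum, hF.eta_eq_sum_shift h1 h2 hj1' hj2', Finset.sum_Ico_succ_top (by omega)]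
      congr 1
      refine Finset.sum_congr rfl fun u hu => ?_
      rw [Finset.mem_Ico] at hu
      exact ((hF.pos_succ_of_chi_lt h1 h2 hj1' hj2' hj (u := u) (by omega) (by omega)).2
        hu.2).1.symm
    · intro u hu1 hu2
      exact ((hF.pos_succ_of_chi_lt h1 h2 hj1' hj2' hj hu1 hu2.le).2 hu2).2
    · by_cases hc : F.chi v (j - 1) = 0
      · exact Or.inl hc
      · rcases hF.pos_chi_succ h1 h2 hj1' hj2' hj (by omega) with h3 | h3
        · exact Or.inr (Or.inr (hbeyond _ (by omega) h3))
        · exact Or.inr (Or.inl h3)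

end IsChain
end Factors

/-! ### Descents and exponents of the inverse permutation -/

theorem exists_last {P : ℕ → Prop} {z v : ℕ} (h : v ≤ z) (hv : P v) :
    ∃ w, v ≤ w ∧ w ≤ z ∧ P w ∧ ∀ u, w < u → u ≤ z → ¬ P u := by
  classical
  exact ⟨Nat.findGreatest P z, Nat.le_findGreatest h hv, Nat.findGreatest_le z,
    Nat.findGreatest_spec h hv, fun u h1 h2 => Nat.findGreatest_is_greatest h1 h2⟩

namespace Factors

theorem mem_indices {F : Factors} {p : Σ _ : ℕ, ℕ} :
    p ∈ F.indices ↔ (1 ≤ p.1 ∧ p.1 ≤ F.z) ∧ 1 ≤ p.2 ∧ p.2 ≤ F.m p.1 := by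
  rw [indices, Finset.mem_sigma, Finset.mem_Icc, Finset.mem_Icc]

namespace IsChain

variable {F : Factors} {n : ℕ}

/-- A descent `k` of the inverse arises at the last level at which `k + 1` comes before `k`; there
`k + 1` starts a block. -/
theorem exists_isStart_of_gt (hF : F.IsChain n) {k : ℕ} (hk : 1 ≤ k)
    (h : F.pos 1 (k + 1) < F.pos 1 k) :
    ∃ v, 1 ≤ v ∧ v ≤ F.z ∧ F.IsStart v (F.pos v (k + 1)) := by
  obtain ⟨v, h1, h2, hv, hmax⟩ := exists_last (P := fun v => F.pos v (k + 1) < F.pos v k)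
    (show 1 ≤ F.z + 1 by omega) h
  have hvz : v ≤ F.z := by
    by_contra hvz
    obtain rfl : v = F.z + 1 := by omega
    rw [pos_top, pos_top] at hv
    omega
  have hne : F.pos (v + 1) k ≠ F.pos (v + 1) (k + 1) := fun h => by
    have := F.pos_injective _ h
    omega
  have hlt : F.pos (v + 1) k < F.pos (v + 1) (k + 1) :=
    lt_of_le_of_ne (not_lt.1 (hmax (v + 1) (by omega) (by omega))) hne
  have hle : F.pos v (k + 1) ≤ F.rho v 1 := by
    by_contra hgt
    rw [← F.factorNat_pos h1, ← F.factorNat_pos h1] at hlt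
    rw [(hF.strictMonoOn_Ioi h1 hvz).lt_iff_lt (Set.mem_Ioi.2 (by omega))
      (Set.mem_Ioi.2 (by omega))] at hlt
    omega
  have hadj := hF.pos_succ_of_lt (by omega) (by omega) (hF.active_succ h1 hvz hle) hlt
  refine ⟨v, h1, hvz, ?_⟩
  by_contra hstart
  obtain ⟨y, hy, -, -, h5⟩ := hF.exists_pred_of_not_isStart h1 hvz
    (hF.pos_pos (by omega) (by omega)) hle hstart
  rw [F.factorNat_pos h1, hadj] at h5
  have h6 := F.pos_eq_of_factorNat_eq (k := k) (y := y) h1 (by omega)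
  omega

theorem mem_kappaMinusValues (hF : F.IsChain n) {k : ℕ} :
    k ∈ F.kappaMinusValues ↔
      k ≠ 0 ∧ ∃ v, 1 ≤ v ∧ v ≤ F.z ∧ F.IsStart v (F.pos v (k + 1)) := by
  rw [kappaMinusValues, Finset.mem_erase, Finset.mem_image]
  refine and_congr_right fun _ => ?_
  constructor
  · rintro ⟨⟨v, j⟩, hp, h⟩
    obtain ⟨⟨h1, h2⟩, hj1, hj2⟩ := mem_indices.1 hp
    exact ⟨v, h1, h2, j, hj1, hj2, (hF.kappaMinus_eq_iff h1 h2 hj1 hj2).1 h⟩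
  · rintro ⟨v, h1, h2, j, hj1, hj2, h⟩
    exact ⟨⟨v, j⟩, mem_indices.2 ⟨⟨h1, h2⟩, hj1, hj2⟩, (hF.kappaMinus_eq_iff h1 h2 hj1 hj2).2 h⟩

theorem mem_kappaMinusValues_iff_gt (hF : F.IsChain n) {k : ℕ} :
    k ∈ F.kappaMinusValues ↔ 1 ≤ k ∧ F.pos 1 (k + 1) < F.pos 1 k := by
  rw [hF.mem_kappaMinusValues]
  constructor
  · rintro ⟨hk, v, h1, h2, h⟩
    exact ⟨by omega, hF.pos_one_gt_of_isStart h1 h2 (by omega) h⟩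
  · rintro ⟨hk, h⟩
    exact ⟨by omega, hF.exists_isStart_of_gt hk h⟩

theorem canonicalExp_kappaPlus (hF : F.IsChain n) {v k : ℕ} (h1 : 1 ≤ v) (h2 : v ≤ F.z)
    (hk : 1 ≤ k) (hv : F.IsEnd v (F.pos v k)) :
    canonicalExp (F.suffixNat 1)⁻¹ k =
      ∑ q ∈ F.indices.filter (fun q => F.kappaPlus q.1 q.2 = k),
        (F.vartheta q.1 q.2 + F.eta q.1 q.2) := by
  have hasc := hF.pos_one_lt_of_isEnd h1 h2 hv
  obtain ⟨w, hw1, hw2, hw, hmax⟩ := exists_last (P := fun v => F.IsEnd v (F.pos v k)) h2 hv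
  rw [hF.sum_kappaPlus (h1.trans hw1) hw2 hw hmax]
  have he := canonicalExp_of_lt (σ := (F.suffixNat 1)⁻¹) hasc
  rw [hF.lehmer_eq_sum_shift hk, hF.lehmer_eq_sum_shift (k := k + 1) (by omega),
    ← Finset.sum_Ico_consecutive _ (show 1 ≤ w + 1 by omega) (show w + 1 ≤ F.z + 1 by omega),
    ← Finset.sum_Ico_consecutive _ (show 1 ≤ w + 1 by omega) (show w + 1 ≤ F.z + 1 by omega),
    Finset.sum_eq_zero (s := Finset.Ico 1 (w + 1)) (f := fun u => F.shift u (F.pos u (k + 1))),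
    (hF.neighbours (v := w + 1) (by omega) (by omega) hk fun u hu1 hu2 =>
      ⟨hmax u (by omega) hu2, fun h => hF.not_isEnd_of_isStart h1 h2 (by omega) hu2 hk h hv⟩).2]
    at he
  · omega
  · intro u hu
    rw [Finset.mem_Ico] at hu
    exact F.shift_eq_zero_of_lt (hF.pos_eq_of_rho_lt hu.1 (by omega) hw2
      (hF.rho_lt_pos_succ_of_isEnd (by omega) hw2 hw)).2

theorem canonicalExp_kappaMinus (hF : F.IsChain n) {v k : ℕ} (h1 : 1 ≤ v) (h2 : v ≤ F.z)
    (hk : 1 ≤ k) (hv : F.IsStart v (F.pos v (k + 1))) :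
    canonicalExp (F.suffixNat 1)⁻¹ k +
      ∑ q ∈ F.indices.filter (fun q => F.kappaMinus q.1 q.2 = k),
        (F.vartheta q.1 q.2 + F.eta q.1 (q.2 - 1)) = k := by
  have hdes := hF.pos_one_gt_of_isStart h1 h2 hk hv
  obtain ⟨w, hw1, hw2, hw, hmax⟩ :=
    exists_last (P := fun v => F.IsStart v (F.pos v (k + 1))) h2 hv
  rw [hF.sum_kappaMinus (h1.trans hw1) hw2 hw hmax]
  have he := canonicalExp_of_gt (σ := (F.suffixNat 1)⁻¹) hdes
  rw [hF.lehmer_eq_sum_shift hk, hF.lehmer_eq_sum_shift (k := k + 1) (by omega),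
    ← Finset.sum_Ico_consecutive _ (show 1 ≤ w + 1 by omega) (show w + 1 ≤ F.z + 1 by omega),
    ← Finset.sum_Ico_consecutive _ (show 1 ≤ w + 1 by omega) (show w + 1 ≤ F.z + 1 by omega),
    Finset.sum_eq_zero (s := Finset.Ico 1 (w + 1)) (f := fun u => F.shift u (F.pos u k)),
    (hF.neighbours (v := w + 1) (by omega) (by omega) hk fun u hu1 hu2 =>
      ⟨hF.not_isEnd_of_isStart (by omega) hu2 h1 h2 hk hv, hmax u (by omega) hu2⟩).2]
    at he
  · omega
  · intro u hu
    rw [Finset.mem_Ico] at hu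
    exact F.shift_eq_zero_of_lt (hF.pos_eq_of_rho_lt hu.1 (by omega) hw2
      (hF.rho_lt_pos_of_isStart (by omega) hw2 hk hw)).2

/-- For `κ_- = 0` the sum is a part of the first term of the Lehmer code, which vanishes. -/
theorem sum_kappaMinus_zero (hF : F.IsChain n) {v : ℕ} (h1 : 1 ≤ v) (h2 : v ≤ F.z)
    (hv : F.IsStart v (F.pos v 1)) :
    ∑ q ∈ F.indices.filter (fun q => F.kappaMinus q.1 q.2 = 0),
        (F.vartheta q.1 q.2 + F.eta q.1 (q.2 - 1)) = 0 := by
  obtain ⟨w, hw1, hw2, hw, hmax⟩ :=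
    exists_last (P := fun v => F.IsStart v (F.pos v (0 + 1))) h2 hv
  rw [hF.sum_kappaMinus (h1.trans hw1) hw2 hw hmax]
  have h3 := hF.lehmer_eq_sum_shift (k := 0 + 1) le_rfl
  rw [lehmer, rankLE_self_succ,
    ← Finset.sum_Ico_consecutive _ (show 1 ≤ w + 1 by omega) (show w + 1 ≤ F.z + 1 by omega)] at h3
  omega

theorem canonicalExp_eq_zero (hF : F.IsChain n) {k : ℕ} (hk : 1 ≤ k)
    (h : ∀ u, 1 ≤ u → u ≤ F.z → ¬ F.IsEnd u (F.pos u k) ∧ ¬ F.IsStart u (F.pos u (k + 1))) :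
    canonicalExp (F.suffixNat 1)⁻¹ k = 0 := by
  have hasc : F.pos 1 k < F.pos 1 (k + 1) := by
    by_contra hle
    have hne : F.pos 1 (k + 1) ≠ F.pos 1 k := fun h => by
      have := F.pos_injective _ h
      omega
    obtain ⟨v, h1, h2, hv⟩ := hF.exists_isStart_of_gt hk (lt_of_le_of_ne (not_lt.1 hle) hne)
    exact (h v h1 h2).2 hv
  have he := canonicalExp_of_lt (σ := (F.suffixNat 1)⁻¹) hasc
  rw [hF.lehmer_eq_sum_shift hk, hF.lehmer_eq_sum_shift (k := k + 1) (by omega),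
    (hF.neighbours le_rfl (by omega) hk h).2] at he
  omega

end IsChain

theorem IsFactorization.suffixNat_one_inv {n : ℕ} {F : Factors} {π : Equiv.Perm (Fin n)}
    (hF : F.IsFactorization n π) : (F.suffixNat 1)⁻¹ = natPerm n π⁻¹ := by
  rw [map_inv, ← (isFactorization_iff.1 hF).2]
  ext k
  exact F.pos_one k

theorem IsFactorization.descents_inv {n : ℕ} {F : Factors} {π : Equiv.Perm (Fin n)}
    (hF : F.IsFactorization n π) : descents π⁻¹ = F.kappaMinusValues := by
  have hc := (isFactorization_iff.1 hF).1
  ext k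
  rw [hc.mem_kappaMinusValues_iff_gt, descents_eq_natDescents, mem_natDescents,
    ← hF.suffixNat_one_inv]
  refine ⟨fun h => h.2, fun h => ⟨?_, h⟩⟩
  -- no descent occurs from `n` on, where the permutation is the identity
  by_contra hnk
  have hfix : ∀ p, n < p → F.pos 1 p = p := fun p hp => by
    rw [pos, hF.suffixNat_one_inv]
    exact natPerm_apply_of_not _ (by omega)
  have h3 := hfix (k + 1) (by omega)
  have h4 := (apply_le_iff_of_fixed (τ := (F.suffixNat 1)⁻¹) (R := k)
    (fun p hp => hfix p (by omega)) k).2 le_rfl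
  have h5 := h.2
  rw [h3] at h5
  rw [pos] at h5
  omega

end Factors

end OGS

theorem mainTheorem8 (n : ℕ) (π : Equiv.Perm (Fin n)) :
    (∃ F : OGS.Factors, F.IsStandard n π) ∧
    ∀ F : OGS.Factors, F.IsStandard n π →
      (∃ e : ℕ → ℕ, OGS.IsCanonicalForm n e π⁻¹ ∧
        (∀ k, e k ≠ 0 →
          ∃ p ∈ F.indices, k = F.kappaMinus p.1 p.2 ∨ k = F.kappaPlus p.1 p.2) ∧
        (∀ p ∈ F.indices,
          e (F.kappaPlus p.1 p.2) =
            ∑ q ∈ F.indices.filter (fun q => F.kappaPlus q.1 q.2 = F.kappaPlus p.1 p.2),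
              (F.vartheta q.1 q.2 + F.eta q.1 q.2)) ∧
        (∀ p ∈ F.indices,
          (e (F.kappaMinus p.1 p.2) : ℤ) =
            (F.kappaMinus p.1 p.2 : ℤ) -
              ∑ q ∈ F.indices.filter (fun q => F.kappaMinus q.1 q.2 = F.kappaMinus p.1 p.2),
                ((F.vartheta q.1 q.2 : ℤ) + (F.eta q.1 (q.2 - 1) : ℤ)))) ∧
      OGS.factorCount n π⁻¹ = F.kappaMinusValues.card ∧
      (∀ G : OGS.Factors, G.IsStandard n π⁻¹ →
        (∀ w ∈ Finset.Icc 1 G.z,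
          OGS.majorIndex (G.factorPerm n w) = G.rho w 1 ∧
          ∃ p ∈ F.indices, OGS.majorIndex (G.factorPerm n w) = F.kappaMinus p.1 p.2) ∧
        (∀ p ∈ F.indices, F.kappaMinus p.1 p.2 ≠ 0 →
          ∃! w, w ∈ Finset.Icc 1 G.z ∧
            OGS.majorIndex (G.factorPerm n w) = F.kappaMinus p.1 p.2)) ∧
      OGS.descents π⁻¹ = F.kappaMinusValues ∧
      (OGS.descents π⁻¹).card = OGS.factorCount n π⁻¹ := by
  refine ⟨OGS.exists_isStandard π, fun F hF => ?_⟩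
  have hc := (OGS.Factors.isFactorization_iff.1 hF.1).1
  have hdes := hF.1.descents_inv
  have hcount := OGS.factorCount_eq_card_descents π⁻¹
  refine ⟨?_, by rw [hcount, hdes], ?_, hdes, hcount.symm⟩
  · have hcan := OGS.isCanonicalForm_canonicalExp π⁻¹
    rw [← hF.1.suffixNat_one_inv] at hcan
    refine ⟨OGS.canonicalExp (F.suffixNat 1)⁻¹, hcan, ?_, ?_, ?_⟩
    · intro k hk
      have hk2 := (hcan.1 k hk).1
      by_contra hno
      push Not at hno
      refine hk (hc.canonicalExp_eq_zero (by omega) fun u h1 h2 => ⟨?_, ?_⟩)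
      · rintro ⟨j, hj1, hj2, h⟩
        exact (hno ⟨u, j⟩ (OGS.Factors.mem_indices.2 ⟨⟨h1, h2⟩, hj1, hj2⟩)).2
          ((hc.kappaPlus_eq_iff h1 h2 hj1 hj2).2 h).symm
      · rintro ⟨j, hj1, hj2, h⟩
        exact (hno ⟨u, j⟩ (OGS.Factors.mem_indices.2 ⟨⟨h1, h2⟩, hj1, hj2⟩)).1
          ((hc.kappaMinus_eq_iff h1 h2 hj1 hj2).2 h).symm
    · rintro ⟨v, j⟩ hp
      obtain ⟨⟨h1, h2⟩, hj1, hj2⟩ := OGS.Factors.mem_indices.1 hp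
      exact hc.canonicalExp_kappaPlus h1 h2
        (hc.suffixNat_kappaPlusStep h1 hj1 hj2 (F.z - v) (by simp only at h2 ⊢; omega)).2.1
        ⟨j, hj1, hj2, (hc.kappaPlus_eq_iff h1 h2 hj1 hj2).1 rfl⟩
    · rintro ⟨v, j⟩ hp
      obtain ⟨⟨h1, h2⟩, hj1, hj2⟩ := OGS.Factors.mem_indices.1 hp
      have hstart : F.IsStart v (F.pos v (F.kappaMinus v j + 1)) :=
        ⟨j, hj1, hj2, (hc.kappaMinus_eq_iff h1 h2 hj1 hj2).1 rfl⟩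
      have key : OGS.canonicalExp (F.suffixNat 1)⁻¹ (F.kappaMinus v j) +
          ∑ q ∈ F.indices.filter (fun q => F.kappaMinus q.1 q.2 = F.kappaMinus v j),
            (F.vartheta q.1 q.2 + F.eta q.1 (q.2 - 1)) = F.kappaMinus v j := by
        rcases Nat.eq_zero_or_pos (F.kappaMinus v j) with h0 | hpos
        · have he : OGS.canonicalExp (F.suffixNat 1)⁻¹ 0 = 0 := by
            by_contra hne
            have := (hcan.1 0 hne).1
            omega
          rw [h0] at hstart ⊢
          rw [he, hc.sum_kappaMinus_zero h1 h2 hstart]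
        · exact hc.canonicalExp_kappaMinus h1 h2 hpos hstart
      have key' := congrArg (Nat.cast : ℕ → ℤ) key
      push_cast at key'
      simp only
      linarith
  · intro G hG
    have hmaj : ∀ w ∈ Finset.Icc 1 G.z, OGS.majorIndex (G.factorPerm n w) = G.rho w 1 :=
      fun w hw => hG.1.majorIndex_factorPerm (Finset.mem_Icc.1 hw).1 (Finset.mem_Icc.1 hw).2
    have himage := hG.descents_eq
    rw [hdes] at himage
    have hGc := (OGS.Factors.isFactorization_iff.1 hG.1).1
    refine ⟨fun w hw => ⟨hmaj w hw, ?_⟩, fun p hp hne => ?_⟩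
    · have hmem : G.rho w 1 ∈ F.kappaMinusValues := by
        rw [himage]
        exact Finset.mem_image_of_mem _ hw
      obtain ⟨p, hp, heq⟩ := Finset.mem_image.1 (Finset.mem_of_mem_erase hmem)
      exact ⟨p, hp, by rw [hmaj w hw, heq]⟩
    · have hmem : F.kappaMinus p.1 p.2 ∈ F.kappaMinusValues :=
        Finset.mem_erase.2 ⟨hne, Finset.mem_image_of_mem _ hp⟩
      rw [himage] at hmem
      obtain ⟨w, hw, heq⟩ := Finset.mem_image.1 hmem
      refine ⟨w, ⟨hw, by rw [hmaj w hw, heq]⟩, ?_⟩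
      rintro w' ⟨hw', heq'⟩
      rw [hmaj w' hw', ← heq] at heq'
      rw [Finset.mem_Icc] at hw hw'
      rcases lt_trichotomy w' w with h | h | h
      · exact absurd heq' (hGc.rho_lt hw'.1 h hw.2).ne
      · exact h
      · exact absurd heq' (hGc.rho_lt hw.1 h hw'.2).ne'
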